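/- Let $\mathbb K\subseteq\mathbb C$ be a subfield, $I$ a countable set and $A=(a_{ij})_{i,j\in I}$ a matrix over $\mathbb K$ such that (B1) $A$ is symmetric, (B2) $a_{ij}\le 0$ for $i\ne j$, and (B3) if $a_{ii}>0$ then $2a_{ij}/a_{ii}\in\mathbb Z$ for all $j\in I$. Let $J=\{i\in I: a_{ii}>0\}$ and assume that $a_{ij}<0$ for all $i\neq j$ in $I\setminus J$. Let $\mathfrak g$ be the Borcherds algebra of $A$: the Lie algebra over $\mathbb K$ with generators $h_i,e_i,f_i$ ($i\in I$) and relations $[h_i,h_j]=0$, $[h_i,e_k]=a_{ik}e_k$, $[h_i,f_k]=-a_{ik}f_k$, $[e_i,f_j]=\delta_{ij}h_i$, $(\mathrm{ad}\,e_i)^{1-2a_{ij}/a_{ii}}e_j=0=(\mathrm{ad}\,f_i)^{1-2a_{ij}/a_{ii}}f_j$ if $i\ne j$ and $a_{ii}>0$, and $[e_i,e_j]=0=[f_i,f_j]$ if $a_{ij}=0$. Let $\mathfrak g_J$ be the subalgebra generated by the $e_j,f_j$ with $j\in J$, let $\mathfrak n_J^-$ be the subalgebra generated by the $f_j$ with $j\in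 J$, and let $V'=\coprod_{i\in I\setminus J}U(\mathfrak n_J^-)\cdot f_i\subset\mathfrak g$, a $\mathfrak g_J$-module under the adjoint action. Let $\pi$ be the representation of $\mathfrak g_J$ by derivations on the tensor algebra $T(V')$ extending this action. Let $G_J\le \mathrm{GL}(T(V'))$ be the Kac--Moody group generated by all $\exp(\pi(x))$, where $x\in(\mathfrak g_J)_\alpha$ and $\alpha$ runs over the real roots of $\mathfrak g_J$ (the Weyl conjugates of the simple roots $\alpha_j$, $j\in J$). Let $S'$ be a basis of $V'$, regarded as a set of non-commuting variables. Let $\widehat A(S')=\{\sum_{n\ge0}u_n : u_n\in A_n(S')\}$ be the algebra of formal power series in these variables, $A_n(S')$ being the span of the words of length $n$. Let $\widehat L(S')\subset\widehat A(S')$ be the Lie subalgebra of series $\sum_{n\ge1}u_n$ with each $u_n$ a Lie polynomial, homogeneous of degree $n$. Let $G(S')$ be the group generated by the elements $\exp(L)$, $L\in\widehat L(S')$. The group $G_J$ acts on $T(V')\cong A(S')$ by graded algebra automorphisms, hence on $\widehat A(S')$ by extending componentwise. This action restricts to an action $\varphi$ on $G(S')$ by group automorphisms, and to an action $\mathrm{Ad}$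 on $\widehat L(S')$ by Lie algebra automorphisms. Let $G=G(S')\rtimes G_J$ be the semi-direct product formed with $\varphi$. Then for all $n_1,n_2\in G(S')$ and $g_1,g_2\in G_J$ the series $L=\log(n_2)=\sum_{k\ge1}\frac{(-1)^{k+1}}{k}(n_2-1)^k$ lies in $\widehat L(S')$, it is the unique element of $\widehat L(S')$ with $\exp(L)=n_2$, and $$(n_1,g_1)\,(n_2,g_2)=\bigl(n_1\cdot\exp(\mathrm{Ad}(g_1)(L)),\;g_1g_2\bigr).$$ -/

import Mathlib

open scoped ComplexOrder

attribute [local instance 100] LieRing.ofAssociativeRing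

noncomputable section

namespace MagnusSemidirect

open Finset

/-! ### Exponentials of locally nilpotent operators -/

section LocallyNilpotent

variable {F W : Type*} [Field F] [AddCommGroup W] [Module F W]

/-- `g` is the exponential of the locally nilpotent operator `D`: every vector `v` is killed by
a power of `D`, and `g v = ∑ₖ Dᵏ v / k!` (a finite sum). -/
def IsExpOf (D : Module.End F W) (g : W ≃ₗ[F] W) : Prop :=
  ∀ v : W, ∃ N : ℕ, (D ^ N) v = 0 ∧ g v = ∑ k ∈ range N, ((k.factorial : F)⁻¹) • (D ^ k) v

theorem pow_apply_eq_zero_of_le {D : Module.End F W} {v : W} {N k : ℕ} (h : (D ^ N) v = 0)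
    (hk : N ≤ k) : (D ^ k) v = 0 := by
  obtain ⟨m, rfl⟩ := Nat.exists_eq_add_of_le' hk
  rw [pow_add, Module.End.mul_apply, h, map_zero]

theorem IsExpOf.apply_eq {D : Module.End F W} {g : W ≃ₗ[F] W} (hg : IsExpOf D g) {v : W} {N : ℕ}
    (h : (D ^ N) v = 0) : g v = ∑ k ∈ range N, ((k.factorial : F)⁻¹) • (D ^ k) v := by
  obtain ⟨M, hM, hgM⟩ := hg v
  have key : ∀ a b : ℕ, a ≤ b → (D ^ a) v = 0 →
      ∑ k ∈ range a, ((k.factorial : F)⁻¹) • (D ^ k) v =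
      ∑ k ∈ range b, ((k.factorial : F)⁻¹) • (D ^ k) v := by
    intro a b hab ha
    refine sum_subset (range_subset_range.2 hab) fun k _ hk => ?_
    rw [pow_apply_eq_zero_of_le ha (by simpa using hk), smul_zero]
  rw [hgM]
  rcases le_total M N with hMN | hMN
  · exact key _ _ hMN hM
  · exact (key _ _ hMN h).symm

/-- A subspace stable under `D` lies in its own image under `exp D`. -/
theorem IsExpOf.exists_preimage {D : Module.End F W} {g : W ≃ₗ[F] W} (hg : IsExpOf D g)
    {P : Submodule F W} (hP : ∀ v ∈ P, D v ∈ P) (N : ℕ) :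
    ∀ v ∈ P, (D ^ N) v = 0 → ∃ u ∈ P, g u = v := by
  have hPk : ∀ (k : ℕ), ∀ v ∈ P, (D ^ k) v ∈ P := by
    intro k
    induction k with
    | zero => intro v hv; simpa using hv
    | succ k ih => intro v hv; rw [pow_succ, Module.End.mul_apply]; exact ih _ (hP v hv)
  induction N with
  | zero => intro v hv h; exact ⟨0, P.zero_mem, by simpa using h.symm⟩
  | succ N ih =>
    intro v hv h
    have h1 : ∀ k : ℕ, ∃ u ∈ P, g u = (D ^ (k + 1)) v := by
      intro k
      refine ih _ (hPk _ v hv) ?_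
      rw [← Module.End.mul_apply, ← pow_add]
      exact pow_apply_eq_zero_of_le h (by omega)
    choose u hu hgu using h1
    refine ⟨v - ∑ k ∈ range N, (((k + 1).factorial : F)⁻¹) • u k,
      P.sub_mem hv (P.sum_mem fun k _ => P.smul_mem _ (hu k)), ?_⟩
    rw [map_sub, map_sum, hg.apply_eq h, sum_range_succ']
    simp [hgu]

theorem IsExpOf.apply_mem {D : Module.End F W} {g : W ≃ₗ[F] W} (hg : IsExpOf D g)
    {P : Submodule F W} (hP : ∀ v ∈ P, D v ∈ P) {v : W} (hv : v ∈ P) : g v ∈ P := by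
  obtain ⟨N, -, h⟩ := hg v
  rw [h]
  have hk : ∀ k : ℕ, (D ^ k) v ∈ P := by
    intro k
    induction k with
    | zero => simpa using hv
    | succ k ih => rw [pow_succ', Module.End.mul_apply]; exact hP _ ih
  exact P.sum_mem fun k _ => P.smul_mem _ (hk k)

theorem IsExpOf.symm_apply_mem {D : Module.End F W} {g : W ≃ₗ[F] W} (hg : IsExpOf D g)
    {P : Submodule F W} (hP : ∀ v ∈ P, D v ∈ P) {v : W} (hv : v ∈ P) : g.symm v ∈ P := by
  obtain ⟨N, hN, -⟩ := hg v
  obtain ⟨u, hu, rfl⟩ := hg.exists_preimage hP N v hv hN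
  simpa using hu

end LocallyNilpotent

section Derivation

variable {F T : Type*} [Field F] [CharZero F] [Ring T] [Algebra F T]

theorem pow_apply_mul (D : Module.End F T) (hD : ∀ a b, D (a * b) = D a * b + a * D b) (n : ℕ)
    (a b : T) : ((n.factorial : F)⁻¹) • (D ^ n) (a * b) =
      ∑ p ∈ antidiagonal n, (((p.1.factorial : F)⁻¹) • (D ^ p.1) a) *
        (((p.2.factorial : F)⁻¹) • (D ^ p.2) b) := by
  have h : ∀ m : ℕ, (D ^ m) (a * b) =
      ∑ p ∈ antidiagonal m, (m.choose p.1 : F) • ((D ^ p.1) a * (D ^ p.2) b) := by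
    intro m
    induction m with
    | zero => simp
    | succ m ih =>
      rw [pow_succ', Module.End.mul_apply, ih, map_sum]
      simp only [map_smul, hD, smul_add, sum_add_distrib]
      have := Finset.sum_antidiagonal_choose_succ_nsmul
        (fun i j => (D ^ i) a * (D ^ j) b) m
      simp only [← Nat.cast_smul_eq_nsmul F] at this
      rw [this, add_comm]
      congr 1
      · refine sum_congr rfl fun p _ => ?_
        rw [pow_succ' D p.2, Module.End.mul_apply]
      · refine sum_congr rfl fun p hp => ?_
        rw [pow_succ' D p.1, Module.End.mul_apply, ← HasAntidiagonal.mem_antidiagonal.1 hp,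
          Nat.choose_symm_add]
  rw [h, smul_sum]
  refine sum_congr rfl fun p hp => ?_
  obtain rfl := HasAntidiagonal.mem_antidiagonal.1 hp
  rw [smul_mul_smul_comm, smul_smul, Nat.choose_symm_add, Nat.add_choose,
    Nat.cast_div]
  · congr 1
    have := Nat.factorial_ne_zero (p.1 + p.2)
    push_cast
    field_simp
  · exact Nat.factorial_mul_factorial_dvd_factorial_add _ _
  · exact_mod_cast mul_ne_zero (Nat.factorial_ne_zero _) (Nat.factorial_ne_zero _)

/-- The exponential of a locally nilpotent derivation is multiplicative. -/
theorem IsExpOf.map_mul {D : Module.End F T} (hD : ∀ a b, D (a * b) = D a * b + a * D b)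
    {g : T ≃ₗ[F] T} (hg : IsExpOf D g) (a b : T) : g (a * b) = g a * g b := by
  obtain ⟨Na, ha, -⟩ := hg a
  obtain ⟨Nb, hb, -⟩ := hg b
  obtain ⟨N, hNa, hNb⟩ : ∃ N, (D ^ N) a = 0 ∧ (D ^ N) b = 0 :=
    ⟨max Na Nb, pow_apply_eq_zero_of_le ha (le_max_left _ _),
      pow_apply_eq_zero_of_le hb (le_max_right _ _)⟩
  have hz : ∀ n, 2 * N ≤ n → ((n.factorial : F)⁻¹) • (D ^ n) (a * b) = 0 := by
    intro n hn
    rw [pow_apply_mul D hD]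
    refine sum_eq_zero fun p hp => ?_
    have := HasAntidiagonal.mem_antidiagonal.1 hp
    rcases le_or_gt N p.1 with h | h
    · rw [pow_apply_eq_zero_of_le hNa h, smul_zero, zero_mul]
    · rw [pow_apply_eq_zero_of_le hNb (k := p.2) (by omega), smul_zero, mul_zero]
  have hab : (D ^ (2 * N)) (a * b) = 0 := by
    have := hz _ le_rfl
    rwa [smul_eq_zero_iff_right
      (inv_ne_zero (Nat.cast_ne_zero.2 (Nat.factorial_ne_zero _)))] at this
  rw [hg.apply_eq hNa, hg.apply_eq hNb, hg.apply_eq hab, sum_mul_sum, ← sum_product']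
  simp only [pow_apply_mul D hD]
  rw [sum_sigma']
  symm
  refine sum_of_injOn (fun p => ⟨p.1 + p.2, p⟩) ?_ ?_ ?_ ?_
  · intro p _ q _ h
    simpa using (Sigma.mk.inj h).2
  · intro p hp
    simp only [coe_product, coe_range, Set.mem_prod, Set.mem_Iio] at hp
    simp only [coe_sigma, Set.mem_sigma_iff, coe_range, Set.mem_Iio, mem_coe, HasAntidiagonal.mem_antidiagonal,
      and_true]
    omega
  · rintro ⟨n, p⟩ hnp hp
    simp only [mem_sigma, mem_range, HasAntidiagonal.mem_antidiagonal] at hnp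
    obtain ⟨-, rfl⟩ := hnp
    have : ¬ (p.1 < N ∧ p.2 < N) := by
      intro h
      exact hp ⟨p, by simpa using h, rfl⟩
    rcases le_or_gt N p.1 with h | h
    · simp only [pow_apply_eq_zero_of_le hNa h, smul_zero, zero_mul]
    · simp only [pow_apply_eq_zero_of_le hNb (k := p.2) (by omega), smul_zero, mul_zero]
  · intro p _
    rfl

end Derivation

/-! ### Derivations of the tensor algebra -/

section TensorDerivation

variable {F V : Type*} [Field F] [AddCommGroup V] [Module F V]

/-- The derivation of `T(V)` extending a linear endomorphism `D` of `V`, that is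
`v₁ ⊗ ⋯ ⊗ vₙ ↦ ∑ⱼ v₁ ⊗ ⋯ ⊗ D vⱼ ⊗ ⋯ ⊗ vₙ`.  It is the second component of the algebra
homomorphism `T(V) → T(V) ⊕ T(V) ε`, `ε² = 0`, with `v ↦ v + D(v) ε`. -/
def tensorDerivation (D : Module.End F V) : Module.End F (TensorAlgebra F V) where
  toFun a := (TensorAlgebra.lift F
    ((TrivSqZeroExt.inlAlgHom F (TensorAlgebra F V) (TensorAlgebra F V)).toLinearMap ∘ₗ
        TensorAlgebra.ι F +
      ((TrivSqZeroExt.inrHom (TensorAlgebra F V) (TensorAlgebra F V)).restrictScalars F) ∘ₗ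
        TensorAlgebra.ι F ∘ₗ D) a).snd
  map_add' a b := by simp
  map_smul' c a := by simp

theorem fst_lift_tensorDerivation (D : Module.End F V) (a : TensorAlgebra F V) :
    (TensorAlgebra.lift F
    ((TrivSqZeroExt.inlAlgHom F (TensorAlgebra F V) (TensorAlgebra F V)).toLinearMap ∘ₗ
        TensorAlgebra.ι F +
      ((TrivSqZeroExt.inrHom (TensorAlgebra F V) (TensorAlgebra F V)).restrictScalars F) ∘ₗ
        TensorAlgebra.ι F ∘ₗ D) a).fst = a := by
  induction a using TensorAlgebra.induction with
  | algebraMap r => simp [AlgHom.commutes, TrivSqZeroExt.algebraMap_eq_inl']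
  | ι v => simp
  | mul a b ha hb => simp [ha, hb]
  | add a b ha hb => simp [ha, hb]

@[simp] theorem tensorDerivation_ι (D : Module.End F V) (v : V) :
    tensorDerivation D (TensorAlgebra.ι F v) = TensorAlgebra.ι F (D v) := by
  simp [tensorDerivation]

@[simp] theorem tensorDerivation_one (D : Module.End F V) : tensorDerivation D 1 = 0 := by
  simp [tensorDerivation]

theorem tensorDerivation_mul (D : Module.End F V) (a b : TensorAlgebra F V) :
    tensorDerivation D (a * b) = tensorDerivation D a * b + a * tensorDerivation D b := by
  simp only [tensorDerivation, LinearMap.coe_mk, AddHom.coe_mk, map_mul, TrivSqZeroExt.snd_mul,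
    fst_lift_tensorDerivation]
  simp [add_comm]

end TensorDerivation

/-! ### The Magnus algebra and the Magnus group -/

section Magnus

variable (F X : Type*) [Field F]

/-- The homogeneous component `A_n(X)` of the free associative algebra `A(X)`: the span of the
words of length `n`. -/
def homogeneousPart (n : ℕ) : Submodule F (FreeAlgebra F X) :=
  (Submodule.span F (Set.range (FreeAlgebra.ι F (X := X)))) ^ n

/-- The Magnus algebra `Â(X)`.  A formal series `u = ∑ₙ uₙ`, `uₙ ∈ A_n(X)`, is stored as the
power series `∑ₙ uₙ tⁿ` in an auxiliary central variable `t`, so that `coeff n u = uₙ`; the product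
is `(u v)ₙ = ∑ₘ uₘ vₙ₋ₘ`. -/
def MagnusAlgebra : Subalgebra F (PowerSeries (FreeAlgebra F X)) where
  carrier := {u | ∀ n, PowerSeries.coeff n u ∈ homogeneousPart F X n}
  mul_mem' := by
    intro u v hu hv n
    rw [PowerSeries.coeff_mul]
    refine Submodule.sum_mem _ fun p hp => ?_
    rw [← HasAntidiagonal.mem_antidiagonal.1 hp, homogeneousPart, pow_add]
    exact Submodule.mul_mem_mul (hu _) (hv _)
  add_mem' := by
    intro u v hu hv n
    rw [map_add]
    exact Submodule.add_mem _ (hu n) (hv n)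
  algebraMap_mem' := by
    intro r n
    rw [PowerSeries.algebraMap_apply, PowerSeries.coeff_C]
    split_ifs with h
    · subst h
      rw [homogeneousPart, pow_zero]
      exact Submodule.algebraMap_mem r
    · exact Submodule.zero_mem _

/-- The free Lie algebra `L(X)`, realised as the Lie subalgebra of `A(X)` generated by `X`. -/
def freeLie : LieSubalgebra F (FreeAlgebra F X) :=
  LieSubalgebra.lieSpan F (FreeAlgebra F X) (Set.range (FreeAlgebra.ι F))

variable {F X}

namespace MagnusAlgebra

/-- The homogeneous component `uₙ` of a series `u ∈ Â(X)`. -/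
def component (n : ℕ) (u : MagnusAlgebra F X) : FreeAlgebra F X :=
  PowerSeries.coeff n (u : PowerSeries (FreeAlgebra F X))

@[ext] theorem ext {u v : MagnusAlgebra F X} (h : ∀ n, component n u = component n v) : u = v :=
  Subtype.ext (PowerSeries.ext h)

theorem component_mem (n : ℕ) (u : MagnusAlgebra F X) : component n u ∈ homogeneousPart F X n :=
  u.2 n

/-- The series with prescribed homogeneous components. -/
def ofComponents (c : ℕ → FreeAlgebra F X) (hc : ∀ n, c n ∈ homogeneousPart F X n) :
    MagnusAlgebra F X :=
  ⟨PowerSeries.mk c, fun n => by rw [PowerSeries.coeff_mk]; exact hc n⟩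

@[simp] theorem component_ofComponents (c : ℕ → FreeAlgebra F X)
    (hc : ∀ n, c n ∈ homogeneousPart F X n) (n : ℕ) : component n (ofComponents c hc) = c n :=
  PowerSeries.coeff_mk n c

theorem component_mul (n : ℕ) (u v : MagnusAlgebra F X) :
    component n (u * v) = ∑ p ∈ antidiagonal n, component p.1 u * component p.2 v :=
  PowerSeries.coeff_mul n _ _

@[simp] theorem component_add (n : ℕ) (u v : MagnusAlgebra F X) :
    component n (u + v) = component n u + component n v := map_add (PowerSeries.coeff n) _ _

@[simp] theorem component_sub (n : ℕ) (u v : MagnusAlgebra F X) :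
    component n (u - v) = component n u - component n v := map_sub (PowerSeries.coeff n) _ _

@[simp] theorem component_zero (n : ℕ) : component n (0 : MagnusAlgebra F X) = 0 :=
  map_zero (PowerSeries.coeff n)

@[simp] theorem component_smul (n : ℕ) (c : F) (u : MagnusAlgebra F X) :
    component n (c • u) = c • component n u := rfl

theorem component_sum {ι : Type*} (n : ℕ) (s : Finset ι) (u : ι → MagnusAlgebra F X) :
    component n (∑ i ∈ s, u i) = ∑ i ∈ s, component n (u i) := by
  classical
  induction s using Finset.induction_on with
  | empty => simp
  | insert a s ha ih => rw [sum_insert ha, sum_insert ha, component_add, ih]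

theorem component_pow_eq_zero {u : MagnusAlgebra F X} (hu : component 0 u = 0) (k : ℕ) :
    ∀ n < k, component n (u ^ k) = 0 := by
  induction k with
  | zero => intro n hn; omega
  | succ k ih =>
    intro n hn
    rw [pow_succ, component_mul]
    refine sum_eq_zero fun p hp => ?_
    have := HasAntidiagonal.mem_antidiagonal.1 hp
    rcases Nat.eq_zero_or_pos p.2 with h | h
    · rw [h, hu, mul_zero]
    · rw [ih _ (by omega), zero_mul]

/-- `exp(u) = ∑ₖ uᵏ / k!` for a series `u` without constant term: as `uᵏ` starts in degree `k`,
only `k ≤ n` contribute to the component of degree `n`. -/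
def exp (u : MagnusAlgebra F X) : MagnusAlgebra F X :=
  ofComponents (fun n => ∑ k ∈ range (n + 1), ((k.factorial : F)⁻¹) • component n (u ^ k))
    fun n => Submodule.sum_mem _ fun k _ => Submodule.smul_mem _ _ (component_mem n (u ^ k))

/-- `log(v) = ∑ₖ (-1)ᵏ⁺¹ (v - 1)ᵏ / k`, `k ≥ 1`, for a series `v` with constant term `1`: as
`(v - 1)ᵏ` starts in degree `k`, only `k ≤ n` contribute to the component of degree `n`. -/
def log (v : MagnusAlgebra F X) : MagnusAlgebra F X :=
  ofComponents
    (fun n => ∑ k ∈ Icc 1 n, ((-1) ^ (k + 1) * (k : F)⁻¹) • component n ((v - 1) ^ k))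
    fun n => Submodule.sum_mem _ fun k _ => Submodule.smul_mem _ _ (component_mem n ((v - 1) ^ k))

/-- A series with constant term `1` has the inverse `∑ₖ (1 - v)ᵏ`. -/
theorem isUnit_of_component_zero {v : MagnusAlgebra F X} (hv : component 0 v = 1) : IsUnit v := by
  set p : MagnusAlgebra F X := 1 - v with hp
  have hp0 : component 0 p = 0 := by
    rw [hp, component_sub, hv, sub_eq_zero]
    exact PowerSeries.coeff_zero_one
  let w : MagnusAlgebra F X := ofComponents
    (fun n => ∑ k ∈ range (n + 1), component n (p ^ k))
    fun n => Submodule.sum_mem _ fun k _ => component_mem n (p ^ k)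
  have hw : ∀ n m, m ≤ n → component m w = component m (∑ k ∈ range (n + 1), p ^ k) := by
    intro n m hmn
    rw [component_sum]
    simp only [w, component_ofComponents]
    refine sum_subset (range_subset_range.2 (by omega)) fun k _ hk => ?_
    exact component_pow_eq_zero hp0 k m (by simpa using hk)
  have hv' : v = 1 - p := by rw [hp]; abel
  have h1 : v * w = 1 := by
    ext n
    have : component n (v * w) = component n (v * ∑ k ∈ range (n + 1), p ^ k) := by
      rw [component_mul, component_mul]
      refine sum_congr rfl fun q hq => ?_
      rw [hw n q.2 (HasAntidiagonal.antidiagonal.snd_le hq)]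
    rw [this, hv', mul_neg_geom_sum, component_sub,
      component_pow_eq_zero hp0 _ _ (Nat.lt_succ_self n), sub_zero]
  have h2 : w * v = 1 := by
    ext n
    have : component n (w * v) = component n ((∑ k ∈ range (n + 1), p ^ k) * v) := by
      rw [component_mul, component_mul]
      refine sum_congr rfl fun q hq => ?_
      rw [hw n q.1 (HasAntidiagonal.antidiagonal.fst_le hq)]
    rw [this, hv', geom_sum_mul_neg, component_sub,
      component_pow_eq_zero hp0 _ _ (Nat.lt_succ_self n), sub_zero]
  exact ⟨⟨v, w, h1, h2⟩, rfl⟩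

theorem isUnit_exp (u : MagnusAlgebra F X) : IsUnit (exp u) := by
  refine isUnit_of_component_zero ?_
  simp only [exp, component_ofComponents, zero_add, range_one, sum_singleton, pow_zero,
    Nat.factorial_zero, Nat.cast_one, inv_one, one_smul]
  exact PowerSeries.coeff_zero_one

end MagnusAlgebra

open MagnusAlgebra

variable (F X)

/-- The completed free Lie algebra `L̂(X)`: the series `∑ₙ uₙ`, `n ≥ 1`, with
`uₙ ∈ L_n(X) = L(X) ∩ A_n(X)`. -/
def completedFreeLie : LieSubalgebra F (MagnusAlgebra F X) where
  carrier := {u | component 0 u = 0 ∧ ∀ n, component n u ∈ freeLie F X}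
  add_mem' := by
    rintro u v ⟨hu0, hu⟩ ⟨hv0, hv⟩
    exact ⟨by simp [hu0, hv0], fun n => by
      rw [component_add]; exact (freeLie F X).add_mem (hu n) (hv n)⟩
  zero_mem' := ⟨component_zero 0, fun n => by
    rw [component_zero]; exact (freeLie F X).zero_mem⟩
  smul_mem' := by
    rintro c u ⟨hu0, hu⟩
    exact ⟨by simp [hu0], fun n => by
      rw [component_smul]; exact (freeLie F X).smul_mem c (hu n)⟩
  lie_mem' := by
    rintro u v ⟨hu0, hu⟩ ⟨hv0, hv⟩
    have h : ∀ n, component n ⁅u, v⁆ =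
        ∑ p ∈ antidiagonal n, ⁅component p.1 u, component p.2 v⁆ := by
      intro n
      rw [LieRing.of_associative_ring_bracket, component_sub, component_mul, component_mul,
        ← Finset.Nat.sum_antidiagonal_swap (f := fun p => component p.1 v * component p.2 u),
        ← sum_sub_distrib]
      rfl
    refine ⟨?_, fun n => ?_⟩
    · rw [h]
      simp [hu0]
    · rw [h]
      exact sum_mem fun p _ => (freeLie F X).lie_mem (hu _) (hv _)

/-- The Magnus group `G(X)`: the subgroup of the group of invertible elements of `Â(X)` generated
by the exponentials of the elements of `L̂(X)`. -/
def magnusGroup : Subgroup (MagnusAlgebra F X)ˣ :=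
  Subgroup.closure {n | ∃ L ∈ completedFreeLie F X, (n : MagnusAlgebra F X) = exp L}

variable {F X}

/-- The exponential map `L̂(X) → G(X)`. -/
def magnusExp (L : completedFreeLie F X) : magnusGroup F X :=
  ⟨(isUnit_exp (L : MagnusAlgebra F X)).unit, Subgroup.subset_closure ⟨L, L.2, rfl⟩⟩

/-! ### Algebra endomorphisms of the completion -/

/-- The continuous extension to `Â(X)` of a degree-preserving algebra endomorphism of `A(X)`:
`∑ₙ uₙ ↦ ∑ₙ g(uₙ)`. -/
def completeHom (g : FreeAlgebra F X →ₐ[F] FreeAlgebra F X)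
    (hg : ∀ x, g (FreeAlgebra.ι F x) ∈ homogeneousPart F X 1) :
    MagnusAlgebra F X →ₐ[F] MagnusAlgebra F X :=
  ((PowerSeries.mapAlgHom g).comp (MagnusAlgebra F X).val).codRestrict (MagnusAlgebra F X) <| by
    have h1 : (Submodule.span F (Set.range (FreeAlgebra.ι F (X := X)))).map g.toLinearMap ≤
        Submodule.span F (Set.range (FreeAlgebra.ι F (X := X))) := by
      rw [Submodule.map_span_le]
      rintro _ ⟨x, rfl⟩
      simpa [homogeneousPart] using hg x
    intro u n
    have h2 := Submodule.mem_map_of_mem (f := g.toLinearMap) (u.2 n)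
    rw [homogeneousPart, Submodule.map_pow] at h2
    have h3 : PowerSeries.coeff n (PowerSeries.mapAlgHom g (u : PowerSeries (FreeAlgebra F X))) =
        g (PowerSeries.coeff n (u : PowerSeries (FreeAlgebra F X))) := PowerSeries.coeff_map _ _ _
    change PowerSeries.coeff n (PowerSeries.mapAlgHom g (u : PowerSeries (FreeAlgebra F X))) ∈
      homogeneousPart F X n
    rw [h3]
    exact pow_le_pow_left' h1 n h2

@[simp] theorem component_completeHom (g : FreeAlgebra F X →ₐ[F] FreeAlgebra F X)
    (hg : ∀ x, g (FreeAlgebra.ι F x) ∈ homogeneousPart F X 1) (n : ℕ) (u : MagnusAlgebra F X) :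
    component n (completeHom g hg u) = g (component n u) :=
  PowerSeries.coeff_map _ _ _

theorem completeHom_exp (g : FreeAlgebra F X →ₐ[F] FreeAlgebra F X)
    (hg : ∀ x, g (FreeAlgebra.ι F x) ∈ homogeneousPart F X 1) (u : MagnusAlgebra F X) :
    completeHom g hg (exp u) = exp (completeHom g hg u) := by
  ext n
  simp [exp, ← map_pow]

theorem completeHom_mem (g : FreeAlgebra F X →ₐ[F] FreeAlgebra F X)
    (hg : ∀ x, g (FreeAlgebra.ι F x) ∈ homogeneousPart F X 1) {u : MagnusAlgebra F X}
    (hu : u ∈ completedFreeLie F X) : completeHom g hg u ∈ completedFreeLie F X := by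
  have h : freeLie F X ≤ (freeLie F X).comap g.toLieHom := by
    refine LieSubalgebra.lieSpan_le.2 ?_
    rintro _ ⟨x, rfl⟩
    have hle : Submodule.span F (Set.range (FreeAlgebra.ι F (X := X))) ≤
        (freeLie F X).toSubmodule := Submodule.span_le.2 LieSubalgebra.subset_lieSpan
    have := hg x
    rw [homogeneousPart, pow_one] at this
    exact hle this
  refine ⟨?_, fun n => ?_⟩
  · rw [component_completeHom, hu.1, map_zero]
  · rw [component_completeHom]
    exact h (hu.2 n)

end Magnus

/-! ### Borcherds algebras -/

section Borcherds

variable {K : Subfield ℂ} {I : Type*}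

/-- The conditions on the defining matrix of a Borcherds algebra, with entries in `K ⊆ ℂ`.
The order is the one of `ℂ`: `z ≤ 0` means that `z` is real and nonpositive. -/
structure IsBorcherdsMatrix (A : Matrix I I K) : Prop where
  symm : ∀ i j, A i j = A j i
  nonpos : ∀ i j, i ≠ j → (A i j : ℂ) ≤ 0
  integral : ∀ i, 0 < (A i i : ℂ) → ∀ j, ∃ m : ℤ, 2 * A i j / A i i = (m : K)

/-- The index set `J` of the real simple roots. -/
def realIndices (A : Matrix I I K) : Set I := {i | 0 < (A i i : ℂ)}

variable (I) in
/-- The generators `hᵢ`, `eᵢ`, `fᵢ`. -/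
inductive Generator
  | h : I → Generator
  | e : I → Generator
  | f : I → Generator

local notation "genH" => fun i => FreeLieAlgebra.of K (Generator.h i)
local notation "genE" => fun i => FreeLieAlgebra.of K (Generator.e i)
local notation "genF" => fun i => FreeLieAlgebra.of K (Generator.f i)

/-- The elements of the free Lie algebra which are set equal to zero in the Borcherds algebra. -/
inductive IsRelator (A : Matrix I I K) : FreeLieAlgebra K (Generator I) → Prop
  | hh (i j : I) : IsRelator A ⁅genH i, genH j⁆
  | he (i k : I) : IsRelator A (⁅genH i, genE k⁆ - A i k • genE k)
  | hf (i k : I) : IsRelator A (⁅genH i, genF k⁆ + A i k • genF k)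
  | ef_same (i : I) : IsRelator A (⁅genE i, genF i⁆ - genH i)
  | ef_ne (i j : I) (hij : i ≠ j) : IsRelator A ⁅genE i, genF j⁆
  | serre_e (i j : I) (n : ℕ) (hij : i ≠ j) (hi : 0 < (A i i : ℂ))
      (hn : (n : K) = -2 * A i j / A i i + 1) :
      IsRelator A (((LieAlgebra.ad K (FreeLieAlgebra K (Generator I)) (genE i)) ^ n) (genE j))
  | serre_f (i j : I) (n : ℕ) (hij : i ≠ j) (hi : 0 < (A i i : ℂ))
      (hn : (n : K) = -2 * A i j / A i i + 1) :
      IsRelator A (((LieAlgebra.ad K (FreeLieAlgebra K (Generator I)) (genF i)) ^ n) (genF j))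
  | ee (i j : I) (hij : A i j = 0) : IsRelator A ⁅genE i, genE j⁆
  | ff (i j : I) (hij : A i j = 0) : IsRelator A ⁅genF i, genF j⁆

/-- The ideal of relations. -/
def relatorIdeal (A : Matrix I I K) : LieIdeal K (FreeLieAlgebra K (Generator I)) :=
  LieSubmodule.lieSpan K (FreeLieAlgebra K (Generator I)) {x | IsRelator A x}

/-- The Borcherds algebra `𝔤` of the matrix `A`. -/
def BorcherdsAlgebra (A : Matrix I I K) : Type _ :=
  FreeLieAlgebra K (Generator I) ⧸ relatorIdeal A

instance (A : Matrix I I K) : LieRing (BorcherdsAlgebra A) :=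
  inferInstanceAs (LieRing (FreeLieAlgebra K (Generator I) ⧸ relatorIdeal A))

instance (A : Matrix I I K) : LieAlgebra K (BorcherdsAlgebra A) :=
  inferInstanceAs (LieAlgebra K (FreeLieAlgebra K (Generator I) ⧸ relatorIdeal A))

variable (A : Matrix I I K)

/-- The canonical projection from the free Lie algebra to `𝔤`. -/
def toBorcherds : FreeLieAlgebra K (Generator I) →ₗ⁅K⁆ BorcherdsAlgebra A :=
  { (LieSubmodule.Quotient.mk' (relatorIdeal A) :
      FreeLieAlgebra K (Generator I) →ₗ[K] FreeLieAlgebra K (Generator I) ⧸ relatorIdeal A) with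
    map_lie' := rfl }

/-- The generator `hᵢ` of `𝔤`. -/
def hGen (i : I) : BorcherdsAlgebra A := toBorcherds A (FreeLieAlgebra.of K (Generator.h i))

/-- The Chevalley generator `eᵢ` of `𝔤`. -/
def eGen (i : I) : BorcherdsAlgebra A := toBorcherds A (FreeLieAlgebra.of K (Generator.e i))

/-- The Chevalley generator `fᵢ` of `𝔤`. -/
def fGen (i : I) : BorcherdsAlgebra A := toBorcherds A (FreeLieAlgebra.of K (Generator.f i))

variable {A} in
theorem toBorcherds_eq_zero {x : FreeLieAlgebra K (Generator I)} (hx : IsRelator A x) :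
    toBorcherds A x = 0 := by
  change (LieSubmodule.Quotient.mk x : FreeLieAlgebra K (Generator I) ⧸ relatorIdeal A) = 0
  exact (LieSubmodule.Quotient.mk_eq_zero' (N := relatorIdeal A)).2 (LieSubmodule.subset_lieSpan hx)

theorem lie_h_f (i k : I) : ⁅hGen A i, fGen A k⁆ = -(A i k • fGen A k) := by
  have := toBorcherds_eq_zero (IsRelator.hf (A := A) i k)
  rw [map_add, LieHom.map_lie, map_smul] at this
  exact eq_neg_of_add_eq_zero_left this

theorem lie_e_f_same (i : I) : ⁅eGen A i, fGen A i⁆ = hGen A i := by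
  have := toBorcherds_eq_zero (IsRelator.ef_same (A := A) i)
  rw [map_sub, LieHom.map_lie] at this
  exact sub_eq_zero.1 this

theorem lie_e_f_ne {i j : I} (hij : i ≠ j) : ⁅eGen A i, fGen A j⁆ = 0 := by
  have := toBorcherds_eq_zero (IsRelator.ef_ne (A := A) i j hij)
  rwa [LieHom.map_lie] at this

/-- The subalgebra `𝔤_J` of `𝔤` generated by the `eⱼ`, `fⱼ` with `j ∈ J`. -/
def gJ : LieSubalgebra K (BorcherdsAlgebra A) :=
  LieSubalgebra.lieSpan K (BorcherdsAlgebra A)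
    (eGen A '' realIndices A ∪ fGen A '' realIndices A)

/-- The negative part `𝔫_J⁻` of `𝔤_J`, generated by the `fⱼ` with `j ∈ J`. -/
def nJneg : LieSubalgebra K (BorcherdsAlgebra A) :=
  LieSubalgebra.lieSpan K (BorcherdsAlgebra A) (fGen A '' realIndices A)

/-- `V'ᵢ = U(𝔫_J⁻) · fᵢ`: the `𝔫_J⁻`-submodule of `𝔤` (adjoint action) generated by `fᵢ`. -/
def moduleVi (i : I) : LieSubmodule K (nJneg A) (BorcherdsAlgebra A) :=
  LieSubmodule.lieSpan K (nJneg A) {fGen A i}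

theorem lie_h_mem_nJneg (k : I) {y : BorcherdsAlgebra A} (hy : y ∈ nJneg A) :
    ⁅hGen A k, y⁆ ∈ nJneg A := by
  induction hy using LieSubalgebra.lieSpan_induction with
  | mem x hx =>
    obtain ⟨j, hj, rfl⟩ := hx
    rw [lie_h_f]
    exact (nJneg A).neg_mem ((nJneg A).smul_mem _ (LieSubalgebra.subset_lieSpan ⟨j, hj, rfl⟩))
  | zero => rw [lie_zero]; exact (nJneg A).zero_mem
  | add x y _ _ hx hy => rw [lie_add]; exact (nJneg A).add_mem hx hy
  | smul c x _ hx => rw [lie_smul]; exact (nJneg A).smul_mem c hx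
  | lie x y hx hy hx' hy' =>
    rw [leibniz_lie]
    exact (nJneg A).add_mem ((nJneg A).lie_mem hx' hy) ((nJneg A).lie_mem hx hy')

/-- `[eⱼ, y] ∈ 𝔫_J⁻ + 𝔥` for `y ∈ 𝔫_J⁻`. -/
theorem lie_e_mem (j : I) {y : BorcherdsAlgebra A} (hy : y ∈ nJneg A) :
    ⁅eGen A j, y⁆ ∈ (nJneg A).toSubmodule ⊔ Submodule.span K (Set.range (hGen A)) := by
  have hstab : ∀ u ∈ (nJneg A).toSubmodule ⊔ Submodule.span K (Set.range (hGen A)),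
      ∀ z ∈ nJneg A, ⁅u, z⁆ ∈ (nJneg A).toSubmodule := by
    intro u hu z hz
    obtain ⟨a, ha, b, hb, rfl⟩ := Submodule.mem_sup.1 hu
    rw [add_lie]
    refine Submodule.add_mem _ ((nJneg A).lie_mem ha hz) ?_
    clear hu
    induction hb using Submodule.span_induction with
    | mem x hx => obtain ⟨k, rfl⟩ := hx; exact lie_h_mem_nJneg A k hz
    | zero => rw [zero_lie]; exact Submodule.zero_mem _
    | add x y _ _ hx hy =>
      rw [add_lie]
      exact Submodule.add_mem _ hx hy
    | smul c x _ hx => rw [smul_lie]; exact Submodule.smul_mem _ c hx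
  induction hy using LieSubalgebra.lieSpan_induction with
  | mem x hx =>
    obtain ⟨k, -, rfl⟩ := hx
    by_cases h : j = k
    · subst h
      rw [lie_e_f_same]
      exact Submodule.mem_sup_right (Submodule.subset_span ⟨j, rfl⟩)
    · rw [lie_e_f_ne A h]
      exact Submodule.zero_mem _
  | zero => rw [lie_zero]; exact Submodule.zero_mem _
  | add x y _ _ hx hy => rw [lie_add]; exact Submodule.add_mem _ hx hy
  | smul c x _ hx => rw [lie_smul]; exact Submodule.smul_mem _ c hx
  | lie x y hx hy hx' hy' =>
    rw [leibniz_lie]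
    refine Submodule.mem_sup_left (Submodule.add_mem _ (hstab _ hx' _ hy) ?_)
    rw [← lie_skew]
    exact Submodule.neg_mem _ (hstab _ hy' _ hx)

theorem lie_h_mem_moduleVi (k i : I) {v : BorcherdsAlgebra A} (hv : v ∈ moduleVi A i) :
    ⁅hGen A k, v⁆ ∈ moduleVi A i := by
  induction hv using LieSubmodule.lieSpan_induction with
  | mem x hx =>
    obtain rfl := Set.mem_singleton_iff.1 hx
    rw [lie_h_f]
    exact neg_mem ((moduleVi A i).smul_mem _ (LieSubmodule.subset_lieSpan rfl))
  | zero => rw [lie_zero]; exact (moduleVi A i).zero_mem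
  | add x y _ _ hx hy => rw [lie_add]; exact add_mem hx hy
  | smul c x _ hx => rw [lie_smul]; exact (moduleVi A i).smul_mem c hx
  | lie y x hx hx' =>
    rw [LieSubalgebra.coe_bracket_of_module, leibniz_lie]
    exact add_mem ((moduleVi A i).lie_mem (x := ⟨_, lie_h_mem_nJneg A k y.2⟩) hx)
      ((moduleVi A i).lie_mem (x := y) hx')

theorem lie_e_mem_moduleVi {j i : I} (hij : j ≠ i) {v : BorcherdsAlgebra A}
    (hv : v ∈ moduleVi A i) : ⁅eGen A j, v⁆ ∈ moduleVi A i := by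
  induction hv using LieSubmodule.lieSpan_induction with
  | mem x hx =>
    obtain rfl := Set.mem_singleton_iff.1 hx
    rw [lie_e_f_ne A hij]
    exact (moduleVi A i).zero_mem
  | zero => rw [lie_zero]; exact (moduleVi A i).zero_mem
  | add x y _ _ hx hy => rw [lie_add]; exact add_mem hx hy
  | smul c x _ hx => rw [lie_smul]; exact (moduleVi A i).smul_mem c hx
  | lie y x hx hx' =>
    rw [LieSubalgebra.coe_bracket_of_module, leibniz_lie]
    refine add_mem ?_ ((moduleVi A i).lie_mem (x := y) hx')
    obtain ⟨a, ha, b, hb, hab⟩ := Submodule.mem_sup.1 (lie_e_mem A j y.2)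
    rw [← hab, add_lie]
    refine add_mem ((moduleVi A i).lie_mem (x := ⟨a, ha⟩) hx) ?_
    clear hab
    induction hb using Submodule.span_induction with
    | mem z hz => obtain ⟨k, rfl⟩ := hz; exact lie_h_mem_moduleVi A k i hx
    | zero => rw [zero_lie]; exact (moduleVi A i).zero_mem
    | add z z' _ _ hz hz' => rw [add_lie]; exact add_mem hz hz'
    | smul c z _ hz => rw [smul_lie]; exact (moduleVi A i).smul_mem c hz

theorem lie_mem_moduleVi {i : I} (hi : i ∉ realIndices A) {x : BorcherdsAlgebra A}
    (hx : x ∈ gJ A) : ∀ v ∈ moduleVi A i, ⁅x, v⁆ ∈ moduleVi A i := by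
  induction hx using LieSubalgebra.lieSpan_induction with
  | mem x hx =>
    intro v hv
    rcases hx with ⟨j, hj, rfl⟩ | ⟨j, hj, rfl⟩
    · exact lie_e_mem_moduleVi A (fun h : j = i => hi (h ▸ hj)) hv
    · exact (moduleVi A i).lie_mem
        (x := ⟨fGen A j, LieSubalgebra.subset_lieSpan ⟨j, hj, rfl⟩⟩) hv
  | zero => intro v _; rw [zero_lie]; exact (moduleVi A i).zero_mem
  | add x y _ _ hx hy => intro v hv; rw [add_lie]; exact add_mem (hx v hv) (hy v hv)
  | smul c x _ hx => intro v hv; rw [smul_lie]; exact (moduleVi A i).smul_mem c (hx v hv)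
  | lie x y _ _ hx hy =>
    intro v hv
    rw [lie_lie]
    exact sub_mem (hx _ (hy v hv)) (hy _ (hx v hv))

/-- The `𝔤_J`-module `V' = ∐ V'ᵢ`, `i ∈ I \ J`, as a subspace of `𝔤` with the adjoint action of
`𝔤_J`. -/
def moduleV : LieSubmodule K (gJ A) (BorcherdsAlgebra A) where
  toSubmodule := ⨆ i : {i // i ∉ realIndices A}, (moduleVi A i).toSubmodule
  lie_mem := by
    intro x v hv
    change v ∈ ⨆ i : {i // i ∉ realIndices A}, (moduleVi A i).toSubmodule at hv
    change ⁅(x : BorcherdsAlgebra A), v⁆ ∈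
      ⨆ i : {i // i ∉ realIndices A}, (moduleVi A i).toSubmodule
    induction hv using Submodule.iSup_induction' with
    | mem i v hv =>
      exact Submodule.mem_iSup_of_mem i (lie_mem_moduleVi A i.2 x.2 v hv)
    | zero => rw [lie_zero]; exact Submodule.zero_mem _
    | add v w _ _ hv hw => rw [lie_add]; exact Submodule.add_mem _ hv hw

/-- The tensor algebra `W = T(V')`. -/
abbrev TensorV : Type _ := TensorAlgebra K (moduleV A)

/-- The representation `π` of `𝔤_J` on `T(V')`: the action on `V'` extended by derivations. -/
def piRep (x : gJ A) : Module.End K (TensorV A) :=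
  tensorDerivation (LieModule.toEnd K (gJ A) (moduleV A) x)

/-! ### Real root spaces -/

/-- `x ∈ 𝔤` is homogeneous of degree `φ = ∑ φᵢ αᵢ` for the grading of `𝔤` by the root lattice,
in which `eᵢ`, `fᵢ`, `hᵢ` have degree `αᵢ`, `-αᵢ`, `0`. -/
inductive IsHomogeneous : (I →₀ ℤ) → BorcherdsAlgebra A → Prop
  | e (i : I) : IsHomogeneous (Finsupp.single i 1) (eGen A i)
  | f (i : I) : IsHomogeneous (-Finsupp.single i 1) (fGen A i)
  | h (i : I) : IsHomogeneous 0 (hGen A i)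
  | zero (φ : I →₀ ℤ) : IsHomogeneous φ 0
  | add {φ : I →₀ ℤ} {x y : BorcherdsAlgebra A} (hx : IsHomogeneous φ x)
      (hy : IsHomogeneous φ y) : IsHomogeneous φ (x + y)
  | smul {φ : I →₀ ℤ} {x : BorcherdsAlgebra A} (c : K) (hx : IsHomogeneous φ x) :
      IsHomogeneous φ (c • x)
  | lie {φ ψ : I →₀ ℤ} {x y : BorcherdsAlgebra A} (hx : IsHomogeneous φ x)
      (hy : IsHomogeneous ψ y) : IsHomogeneous (φ + ψ) ⁅x, y⁆

/-- The real roots `Δ_J^re` of `𝔤_J`: the orbit of the simple roots `αⱼ`, `j ∈ J`, under the Weyl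
group, which is generated by the reflections `φ ↦ φ - (2 (φ, αⱼ) / (αⱼ, αⱼ)) αⱼ`, `j ∈ J`. -/
inductive IsRealRoot : (I →₀ ℤ) → Prop
  | simple (j : I) (hj : j ∈ realIndices A) : IsRealRoot (Finsupp.single j 1)
  | reflect (j : I) (hj : j ∈ realIndices A) (φ : I →₀ ℤ) (hφ : IsRealRoot φ) (m : ℤ)
      (hm : (m : K) = 2 * (φ.sum fun i c => (c : K) * A i j) / A j j) :
      IsRealRoot (φ - m • Finsupp.single j 1)

/-! ### The group `G_J` and its action -/

/-- The Kac--Moody group `G_J` relative to `W = T(V')`: the subgroup of `GL(W)` generated by the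
`exp (π x)` with `x ∈ (𝔤_J)_α`, `α ∈ Δ_J^re`. -/
def groupGJ : Subgroup (TensorV A ≃ₗ[K] TensorV A) :=
  Subgroup.closure {g | ∃ (α : I →₀ ℤ) (x : gJ A), IsRealRoot A α ∧
    IsHomogeneous A α (x : BorcherdsAlgebra A) ∧ IsExpOf (piRep A x) g}

/-- The elements of `G_J` are graded algebra automorphisms of `T(V')`. -/
theorem groupGJ_spec {g : TensorV A ≃ₗ[K] TensorV A} (hg : g ∈ groupGJ A) :
    g 1 = 1 ∧ (∀ a b, g (a * b) = g a * g b) ∧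
      (∀ v ∈ LinearMap.range (TensorAlgebra.ι K (M := moduleV A)),
        g v ∈ LinearMap.range (TensorAlgebra.ι K (M := moduleV A))) ∧
      ∀ v ∈ LinearMap.range (TensorAlgebra.ι K (M := moduleV A)),
        g.symm v ∈ LinearMap.range (TensorAlgebra.ι K (M := moduleV A)) := by
  induction hg using Subgroup.closure_induction with
  | mem g hg =>
    obtain ⟨α, x, -, -, hx⟩ := hg
    have hD : ∀ v ∈ LinearMap.range (TensorAlgebra.ι K (M := moduleV A)),
        piRep A x v ∈ LinearMap.range (TensorAlgebra.ι K (M := moduleV A)) := by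
      rintro _ ⟨v, rfl⟩
      exact ⟨_, (tensorDerivation_ι _ v).symm⟩
    refine ⟨?_, hx.map_mul (tensorDerivation_mul _), fun v hv => hx.apply_mem hD hv,
      fun v hv => hx.symm_apply_mem hD hv⟩
    rw [hx.apply_eq (N := 1) (by rw [pow_one]; exact tensorDerivation_one _)]
    simp
  | one => exact ⟨rfl, fun _ _ => rfl, fun v hv => hv, fun v hv => hv⟩
  | mul g g' _ _ hg hg' =>
    refine ⟨?_, fun a b => ?_, fun v hv => hg.2.2.1 _ (hg'.2.2.1 v hv),
      fun v hv => hg'.2.2.2 _ (hg.2.2.2 v hv)⟩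
    · rw [LinearEquiv.mul_apply, hg'.1, hg.1]
    · rw [LinearEquiv.mul_apply, hg'.2.1, hg.2.1]; rfl
  | inv g _ hg =>
    refine ⟨?_, fun a b => ?_, hg.2.2.2, hg.2.2.1⟩
    · exact g.symm_apply_eq.2 hg.1.symm
    · refine g.symm_apply_eq.2 ?_
      rw [hg.2.1]
      congr 1
      · exact (g.apply_symm_apply a).symm
      · exact (g.apply_symm_apply b).symm

variable {A}

/-- The action of `g ∈ G_J` on `T(V')` as an algebra homomorphism. -/
def groupGJ.toAlgHom (g : groupGJ A) : TensorV A →ₐ[K] TensorV A :=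
  AlgHom.ofLinearMap (g : TensorV A ≃ₗ[K] TensorV A).toLinearMap (groupGJ_spec A g.2).1
    (groupGJ_spec A g.2).2.1

variable {S : Type*} (b : Module.Basis S K (moduleV A))

/-- The action of `g ∈ G_J` on `A(S')`, transported along the isomorphism `T(V') ≃ A(S')` sending
the basis vector `b s` to the formal variable `s`. -/
def freeAction (g : groupGJ A) : FreeAlgebra K S →ₐ[K] FreeAlgebra K S :=
  ((TensorAlgebra.equivFreeAlgebra b).toAlgHom.comp (groupGJ.toAlgHom g)).comp
    (TensorAlgebra.equivFreeAlgebra b).symm.toAlgHom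

theorem equivFreeAlgebra_ι_mem (v : moduleV A) :
    TensorAlgebra.equivFreeAlgebra b (TensorAlgebra.ι K v) ∈ homogeneousPart K S 1 := by
  rw [homogeneousPart, pow_one]
  induction b.mem_span v using Submodule.span_induction with
  | mem v hv =>
    obtain ⟨s, rfl⟩ := hv
    rw [TensorAlgebra.equivFreeAlgebra_ι_apply]
    exact Submodule.subset_span ⟨s, rfl⟩
  | zero => rw [map_zero, map_zero]; exact Submodule.zero_mem _
  | add v w _ _ hv hw => rw [map_add, map_add]; exact Submodule.add_mem _ hv hw
  | smul c v _ hv => rw [map_smul, map_smul]; exact Submodule.smul_mem _ c hv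

theorem freeAction_ι_mem (g : groupGJ A) (s : S) :
    freeAction b g (FreeAlgebra.ι K s) ∈ homogeneousPart K S 1 := by
  obtain ⟨v, hv⟩ := (groupGJ_spec A g.2).2.2.1 (TensorAlgebra.ι K (b s)) ⟨b s, rfl⟩
  have : freeAction b g (FreeAlgebra.ι K s) =
      TensorAlgebra.equivFreeAlgebra b (TensorAlgebra.ι K v) := by
    rw [hv, ← TensorAlgebra.equivFreeAlgebra_symm_ι]
    rfl
  rw [this]
  exact equivFreeAlgebra_ι_mem b v

/-- The action of `g ∈ G_J` on `Â(S') ≃ T̂(V')`, extended from `A(S') ≃ T(V')` by continuity. -/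
def magnusAction (g : groupGJ A) : MagnusAlgebra K S →ₐ[K] MagnusAlgebra K S :=
  completeHom (freeAction b g) (freeAction_ι_mem b g)

theorem magnusAction_one (u : MagnusAlgebra K S) : magnusAction b 1 u = u := by
  refine MagnusAlgebra.ext fun n => ?_
  rw [magnusAction, component_completeHom]
  exact (TensorAlgebra.equivFreeAlgebra b).apply_symm_apply _

theorem magnusAction_mul (g g' : groupGJ A) (u : MagnusAlgebra K S) :
    magnusAction b (g * g') u = magnusAction b g (magnusAction b g' u) := by
  refine MagnusAlgebra.ext fun n => ?_
  simp only [magnusAction, component_completeHom]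
  change _ = TensorAlgebra.equivFreeAlgebra b ((g : TensorV A ≃ₗ[K] TensorV A)
    ((TensorAlgebra.equivFreeAlgebra b).symm (TensorAlgebra.equivFreeAlgebra b _)))
  rw [(TensorAlgebra.equivFreeAlgebra b).symm_apply_apply]
  rfl

/-- `Ad(g)` on `L̂(S')`: the action `L ↦ g · L` of `g ∈ G_J` on `Â(S')`, restricted to the
completed free Lie algebra `L̂(S')`. -/
def adjointAction (g : groupGJ A) : completedFreeLie K S →ₗ⁅K⁆ completedFreeLie K S where
  toFun L := ⟨magnusAction b g L, completeHom_mem _ _ L.2⟩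
  map_add' L L' := Subtype.ext (map_add (magnusAction b g) _ _)
  map_smul' c L := Subtype.ext (map_smul (magnusAction b g) c _)
  map_lie' := by
    intro L L'
    exact Subtype.ext ((magnusAction b g).toLieHom.map_lie _ _)

/-- As operators on `Â(S')`, with series acting by left multiplication, `Ad(g)(L) = g L g⁻¹`. -/
theorem adjointAction_mul (g : groupGJ A) (L : completedFreeLie K S) (u : MagnusAlgebra K S) :
    (adjointAction b g L : MagnusAlgebra K S) * u =
      magnusAction b g ((L : MagnusAlgebra K S) * magnusAction b g⁻¹ u) := by
  rw [map_mul, ← magnusAction_mul, mul_inv_cancel, magnusAction_one]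
  rfl

/-- The action `φ` of `G_J` on the group `G(S')` by automorphisms, restricted from the action of
`G_J` on `Â(S')`. -/
def magnusGroupAction : groupGJ A →* MulAut (magnusGroup K S) := by
  have key : ∀ (g : groupGJ A) (n : (MagnusAlgebra K S)ˣ), n ∈ magnusGroup K S →
      Units.map (magnusAction b g : MagnusAlgebra K S →* MagnusAlgebra K S) n ∈
        magnusGroup K S := by
    intro g n hn
    have h : magnusGroup K S ≤ (magnusGroup K S).comap
        (Units.map (magnusAction b g : MagnusAlgebra K S →* MagnusAlgebra K S)) := by
      refine (Subgroup.closure_le _).2 ?_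
      rintro n ⟨L, hL, hn⟩
      refine Subgroup.subset_closure ⟨_, completeHom_mem _ (freeAction_ι_mem b g) hL, ?_⟩
      rw [← completeHom_exp, ← hn]
      rfl
    exact h hn
  exact
  { toFun := fun g =>
      { toFun := fun n => ⟨Units.map (magnusAction b g : MagnusAlgebra K S →* MagnusAlgebra K S) n,
          key g n n.2⟩
        invFun := fun n =>
          ⟨Units.map (magnusAction b g⁻¹ : MagnusAlgebra K S →* MagnusAlgebra K S) n,
            key g⁻¹ n n.2⟩
        left_inv := fun n => Subtype.ext (Units.ext (by
          change magnusAction b g⁻¹ (magnusAction b g _) = _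
          rw [← magnusAction_mul, inv_mul_cancel, magnusAction_one]))
        right_inv := fun n => Subtype.ext (Units.ext (by
          change magnusAction b g (magnusAction b g⁻¹ _) = _
          rw [← magnusAction_mul, mul_inv_cancel, magnusAction_one]))
        map_mul' := fun n n' => Subtype.ext (Units.ext (map_mul (magnusAction b g) _ _)) }
    map_one' := MulEquiv.ext fun n => Subtype.ext (Units.ext (magnusAction_one b _))
    map_mul' := fun g g' =>
      MulEquiv.ext fun n => Subtype.ext (Units.ext (magnusAction_mul b g g' _)) }

/-- The semi-direct product `G = G(S') ⋊ G_J`. -/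
abbrev SemidirectGroup : Type _ := magnusGroup K S ⋊[magnusGroupAction b] groupGJ A

end Borcherds

end MagnusSemidirect

end

/-!
The law of the semidirect product reads `(n₁, g₁) (n₂, g₂) = (n₁ · φ(g₁)(n₂), g₁ g₂)`.  As `g₁` acts
on `Â(S')` componentwise through an algebra homomorphism, `φ(g₁)(exp L) = exp(Ad(g₁)(L))`
(`completeHom_exp`).  What has to be shown is that every element of the Magnus group is the
exponential of exactly one Lie series, namely of its logarithm.  This is the qualitative
Baker--Campbell--Hausdorff theorem, and it holds over any field of characteristic zero.

Let `D` be the derivation of `Â(X)` multiplying the component of degree `n` by `n`.  For a Lie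
series `L` the formulas

* `e^L w e^{-L} = ∑ₖ (1 / k!) (ad L)ᵏ w`,
* `e^L D(e^{-L}) = -∑ₖ (1 / (k + 1)!) (ad L)ᵏ (D L)`

show that conjugation by `e^L` preserves the Lie series and that `e^L D(e^{-L})` is a Lie series.
Both are instances of `e^{ad L} T = e^L T e^{-L}` for linear operators `T` on `Â(X)`
(`exp_mul_map_exp_neg_sub_sum_mem`), the second one because `[L, D]` is left multiplication by
`-D L`.  Since `g ↦ g D(g⁻¹)` is a crossed homomorphism, `g D(g⁻¹)` is a Lie series for every `g`
in the Magnus group (`mul_degreeDerivation_inv_mem`).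

Conversely, write `g = e^u` with `u = log g`, which is possible by the power series identity
`exp(log(1 + X)) = 1 + X` (`exp_log`).  The component of degree `n` of `g D(g⁻¹)` is `-n uₙ` plus a
combination of iterated brackets of components of `u` of degree less than `n`, so that the `uₙ` are
Lie elements by induction on `n` (`mem_completedFreeLie_of_exp_mul_degreeDerivation_mem`).

Identities between infinite sums in `Â(X)` are proved modulo the terms `degreeGE n` of the degree
filtration, for all `n`.
-/

noncomputable section

open Finset

/-! ### The exponential of the logarithm as a power series in one variable -/

/-- With `g = (1 + X)⁻¹ = log'`, the series `f = exp ∘ log` satisfies `f' = f g`, so that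
`(f g)' = 0`. -/
theorem PowerSeries.exp_subst_log (F : Type*) [Field F] [CharZero F] :
    (PowerSeries.exp F).subst (PowerSeries.log F) = 1 + PowerSeries.X := by
  have hs : PowerSeries.HasSubst (PowerSeries.log F) := PowerSeries.HasSubst.log
  set f : PowerSeries F := (PowerSeries.exp F).subst (PowerSeries.log F) with hf
  set g : PowerSeries F := PowerSeries.derivative F (PowerSeries.log F) with hg
  have hgX : (1 + PowerSeries.X) * g = 1 := by
    rw [hg, PowerSeries.deriv_log]
    ext n
    cases n with
    | zero => simp [add_mul]
    | succ n => simp [add_mul, PowerSeries.coeff_succ_X_mul, PowerSeries.coeff_one, pow_succ]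
  have hf' : PowerSeries.derivative F f = f * g := by
    rw [hf, PowerSeries.derivative_subst hs, PowerSeries.derivative_exp]
  have hg' : g * g + PowerSeries.derivative F g = 0 := by
    have h := congrArg (PowerSeries.derivative F) hgX
    simp only [Derivation.leibniz, map_add, Derivation.map_one_eq_zero, PowerSeries.derivative_X,
      smul_eq_mul] at h
    linear_combination g * h - PowerSeries.derivative F g * hgX
  have hfg : f * g = 1 := by
    refine PowerSeries.derivative.ext ?_ ?_
    · simp only [Derivation.leibniz, hf', smul_eq_mul, Derivation.map_one_eq_zero]
      linear_combination f * hg'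
    · have h0 : PowerSeries.constantCoeff f = 1 := by
        rw [← PowerSeries.coeff_zero_eq_constantCoeff_apply, hf, PowerSeries.coeff_subst' hs,
          finsum_eq_single _ 0]
        · simp
        · intro k hk
          simp [hk]
      rw [map_mul, h0, hg, PowerSeries.deriv_log]
      simp
  linear_combination (1 + PowerSeries.X) * hfg - f * hgX

namespace MagnusSemidirect

namespace MagnusAlgebra

variable {F X : Type*} [Field F]

/-! ### The degree filtration of the Magnus algebra -/

theorem component_one (n : ℕ) :
    component n (1 : MagnusAlgebra F X) = if n = 0 then 1 else 0 :=
  PowerSeries.coeff_one n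

@[simp] theorem component_neg (n : ℕ) (u : MagnusAlgebra F X) :
    component n (-u) = -component n u := map_neg (PowerSeries.coeff n) _

variable (F X) in
/-- The series all of whose components of degree less than `n` vanish. -/
def degreeGE (n : ℕ) : Submodule F (MagnusAlgebra F X) where
  carrier := {u | ∀ m < n, component m u = 0}
  add_mem' hu hv m hm := by rw [component_add, hu m hm, hv m hm, add_zero]
  zero_mem' m _ := component_zero m
  smul_mem' c u hu m hm := by rw [component_smul, hu m hm, smul_zero]

theorem degreeGE_anti {m n : ℕ} (h : m ≤ n) : degreeGE F X n ≤ degreeGE F X m :=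
  fun _ hu _ hk => hu _ (hk.trans_le h)

theorem mem_degreeGE_zero (u : MagnusAlgebra F X) : u ∈ degreeGE F X 0 :=
  fun _ hm => absurd hm (Nat.not_lt_zero _)

theorem mem_degreeGE_one {u : MagnusAlgebra F X} : u ∈ degreeGE F X 1 ↔ component 0 u = 0 :=
  ⟨fun h => h 0 Nat.one_pos, fun h m hm => by rwa [Nat.lt_one_iff.1 hm]⟩

theorem mul_mem_degreeGE {m n : ℕ} {u v : MagnusAlgebra F X} (hu : u ∈ degreeGE F X m)
    (hv : v ∈ degreeGE F X n) : u * v ∈ degreeGE F X (m + n) := by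
  intro k hk
  rw [component_mul]
  refine sum_eq_zero fun p hp => ?_
  have := HasAntidiagonal.mem_antidiagonal.1 hp
  rcases lt_or_ge p.1 m with h | h
  · rw [hu _ h, zero_mul]
  · rw [hv p.2 (by omega), mul_zero]

theorem mul_mem_degreeGE_right {n : ℕ} (u : MagnusAlgebra F X) {v : MagnusAlgebra F X}
    (hv : v ∈ degreeGE F X n) : u * v ∈ degreeGE F X n := by
  simpa using mul_mem_degreeGE (mem_degreeGE_zero u) hv

theorem mul_mem_degreeGE_left {n : ℕ} {u : MagnusAlgebra F X} (hu : u ∈ degreeGE F X n)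
    (v : MagnusAlgebra F X) : u * v ∈ degreeGE F X n :=
  mul_mem_degreeGE hu (mem_degreeGE_zero v)

theorem pow_mem_degreeGE {u : MagnusAlgebra F X} (hu : component 0 u = 0) (k : ℕ) :
    u ^ k ∈ degreeGE F X k :=
  component_pow_eq_zero hu k

theorem component_eq_of_sub_mem {n : ℕ} {u v : MagnusAlgebra F X} (h : u - v ∈ degreeGE F X n)
    {m : ℕ} (hm : m < n) : component m u = component m v := by
  have := h m hm
  rwa [component_sub, sub_eq_zero] at this

theorem eq_of_sub_mem_degreeGE {u v : MagnusAlgebra F X} (h : ∀ n, u - v ∈ degreeGE F X n) :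
    u = v :=
  ext fun n => component_eq_of_sub_mem (h (n + 1)) (Nat.lt_succ_self n)

/-- The square and the triangular partial sums of a double series whose `(i, j)` term starts in
degree `i + j` agree up to terms of high degree. -/
theorem sum_square_sub_sum_triangle_mem (f : ℕ → ℕ → MagnusAlgebra F X)
    (hf : ∀ i j, f i j ∈ degreeGE F X (i + j)) (N : ℕ) :
    ∑ i ∈ range N, ∑ j ∈ range N, f i j - ∑ k ∈ range N, ∑ p ∈ antidiagonal k, f p.1 p.2 ∈
      degreeGE F X N := by
  have h : ∑ k ∈ range N, ∑ p ∈ antidiagonal k, f p.1 p.2 =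
      ∑ p ∈ range N ×ˢ range N with p.1 + p.2 < N, f p.1 p.2 := by
    rw [sum_sigma']
    refine sum_bij' (fun x _ => x.2) (fun p _ => ⟨p.1 + p.2, p⟩) ?_ ?_ ?_ ?_ ?_
    · rintro ⟨k, p⟩ hp
      simp only [mem_sigma, mem_range, HasAntidiagonal.mem_antidiagonal] at hp
      simp only [mem_filter, mem_product, mem_range]
      omega
    · intro p hp
      simp only [mem_filter] at hp
      simpa using hp.2
    · rintro ⟨k, p⟩ hp
      simp only [mem_sigma, mem_range, HasAntidiagonal.mem_antidiagonal] at hp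
      obtain ⟨-, rfl⟩ := hp
      rfl
    · intro p _
      rfl
    · intro x _
      rfl
  rw [← sum_product', h, ← sum_filter_add_sum_filter_not (range N ×ˢ range N)
    (fun p => p.1 + p.2 < N), add_sub_cancel_left]
  refine Submodule.sum_mem _ fun p hp => degreeGE_anti ?_ (hf p.1 p.2)
  simpa using (mem_filter.1 hp).2

/-! ### Evaluation of power series in one variable -/

/-- The value `∑ₖ pₖ uᵏ` of a power series `p` in one variable at a series `u` without constant
term: as `uᵏ` starts in degree `k`, only `k ≤ n` contribute to the component of degree `n`. -/
def evalSeries (u : MagnusAlgebra F X) (p : PowerSeries F) : MagnusAlgebra F X :=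
  ofComponents (fun n => ∑ k ∈ range (n + 1), PowerSeries.coeff k p • component n (u ^ k))
    fun n => Submodule.sum_mem _ fun k _ => Submodule.smul_mem _ _ (component_mem n (u ^ k))

theorem evalSeries_sub_sum_mem {u : MagnusAlgebra F X} (hu : component 0 u = 0)
    (p : PowerSeries F) (N : ℕ) :
    evalSeries u p - ∑ k ∈ range N, PowerSeries.coeff k p • u ^ k ∈ degreeGE F X N := by
  intro m hm
  rw [component_sub, sub_eq_zero, component_sum]
  simp only [evalSeries, component_ofComponents, component_smul]
  refine sum_subset (range_subset_range.2 hm) fun k _ hk => ?_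
  rw [component_pow_eq_zero hu k m (by simpa using hk), smul_zero]

theorem evalSeries_mul {u : MagnusAlgebra F X} (hu : component 0 u = 0) (p q : PowerSeries F) :
    evalSeries u (p * q) = evalSeries u p * evalSeries u q := by
  refine eq_of_sub_mem_degreeGE fun N => ?_
  set P := ∑ k ∈ range N, PowerSeries.coeff k p • u ^ k with hP
  set Q := ∑ k ∈ range N, PowerSeries.coeff k q • u ^ k with hQ
  have h1 := evalSeries_sub_sum_mem hu (p * q) N
  have h2 := mul_mem_degreeGE_left (evalSeries_sub_sum_mem hu p N) Q
  have h3 := mul_mem_degreeGE_right (evalSeries u p) (evalSeries_sub_sum_mem hu q N)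
  rw [← hP] at h2
  rw [← hQ] at h3
  have h4 := sum_square_sub_sum_triangle_mem
    (fun i j => (PowerSeries.coeff i p • u ^ i) * (PowerSeries.coeff j q • u ^ j))
    (fun i j => mul_mem_degreeGE (Submodule.smul_mem _ _ (pow_mem_degreeGE hu i))
      (Submodule.smul_mem _ _ (pow_mem_degreeGE hu j))) N
  rw [← sum_mul_sum, ← hP, ← hQ] at h4
  have h5 : ∑ k ∈ range N, PowerSeries.coeff k (p * q) • u ^ k =
      ∑ k ∈ range N, ∑ x ∈ antidiagonal k,
        (PowerSeries.coeff x.1 p • u ^ x.1) * (PowerSeries.coeff x.2 q • u ^ x.2) := by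
    refine sum_congr rfl fun k _ => ?_
    rw [PowerSeries.coeff_mul, sum_smul]
    refine sum_congr rfl fun x hx => ?_
    rw [smul_mul_smul_comm, ← pow_add, HasAntidiagonal.mem_antidiagonal.1 hx]
  rw [h5] at h1
  have := sub_mem (sub_mem (sub_mem h1 h4) h2) h3
  convert this using 1
  rw [sub_mul, mul_sub]
  abel

theorem evalSeries_one (u : MagnusAlgebra F X) : evalSeries u 1 = 1 := by
  ext n
  simp only [evalSeries, component_ofComponents, PowerSeries.coeff_one, ite_smul, one_smul,
    zero_smul]
  rw [sum_ite_eq' (range (n + 1)) 0]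
  simp

theorem evalSeries_pow {u : MagnusAlgebra F X} (hu : component 0 u = 0) (p : PowerSeries F)
    (k : ℕ) : evalSeries u (p ^ k) = evalSeries u p ^ k := by
  induction k with
  | zero => rw [pow_zero, pow_zero, evalSeries_one]
  | succ k ih => rw [pow_succ, pow_succ, evalSeries_mul hu, ih]

theorem component_zero_log (v : MagnusAlgebra F X) : component 0 (log v) = 0 := by
  simp [log]

section CharZero

variable [CharZero F]

theorem log_eq_evalSeries (v : MagnusAlgebra F X) :
    log v = evalSeries (v - 1) (PowerSeries.log F) := by
  ext n
  simp only [log, evalSeries, component_ofComponents]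
  rw [range_eq_Ico, sum_eq_sum_Ico_succ_bot (Nat.succ_pos n)]
  simp only [PowerSeries.coeff_log, if_true, zero_smul, zero_add]
  refine sum_congr rfl fun k hk => ?_
  rw [if_neg (by have := mem_Ico.1 hk; omega)]
  simp [div_eq_mul_inv]

theorem exp_evalSeries {u : MagnusAlgebra F X} (hu : component 0 u = 0) {p : PowerSeries F}
    (hp : PowerSeries.constantCoeff p = 0) :
    exp (evalSeries u p) = evalSeries u ((PowerSeries.exp F).subst p) := by
  ext n
  simp only [exp, component_ofComponents, ← evalSeries_pow hu]
  simp only [evalSeries, component_ofComponents, smul_sum]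
  rw [sum_comm]
  refine sum_congr rfl fun j hj => ?_
  have hs : PowerSeries.HasSubst p := PowerSeries.HasSubst.of_constantCoeff_zero' hp
  rw [PowerSeries.coeff_subst' hs, finsum_eq_sum_of_support_subset (s := range (n + 1)), sum_smul]
  · refine sum_congr rfl fun k _ => ?_
    simp [PowerSeries.coeff_exp, smul_smul]
  · intro k hk
    by_contra hkn
    refine hk ?_
    have : PowerSeries.coeff j (p ^ k) = 0 := by
      refine PowerSeries.coeff_of_lt_order _ ?_
      have h1 : (k : ℕ∞) ≤ (p ^ k).order :=
        PowerSeries.le_order_pow_of_constantCoeff_eq_zero k hp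
      refine lt_of_lt_of_le ?_ h1
      simp only [coe_range, Set.mem_Iio, mem_range] at hkn hj
      exact_mod_cast (by omega : j < k)
    simp [this]

theorem exp_log {v : MagnusAlgebra F X} (hv : component 0 v = 1) : exp (log v) = v := by
  have hu : component 0 (v - 1) = 0 := by rw [component_sub, hv, component_one]; simp
  rw [log_eq_evalSeries, exp_evalSeries hu PowerSeries.constantCoeff_log,
    PowerSeries.exp_subst_log]
  refine eq_of_sub_mem_degreeGE fun N => ?_
  refine degreeGE_anti (Nat.le_add_right N 2) ?_
  convert evalSeries_sub_sum_mem hu (1 + PowerSeries.X) (N + 2) using 2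
  rw [sum_range_succ', sum_range_succ', sum_eq_zero]
  · simp [PowerSeries.coeff_one]
  · intro k _
    simp [PowerSeries.coeff_one, PowerSeries.coeff_X]

end CharZero

end MagnusAlgebra

end MagnusSemidirect

/-! ### Exponentials and the adjoint action -/

/-- The degree `k` part of `e^{ad u} t = e^u t e^{-u}`: `ad u` is the sum of the commuting operators
of left multiplication by `u` and right multiplication by `-u`. -/
theorem LieAlgebra.inv_factorial_smul_ad_pow {F R : Type*} [Field F] [CharZero F] [Ring R]
    [Algebra F R] (u t : R) (k : ℕ) :
    ((k.factorial : F)⁻¹) • ((LieAlgebra.ad F R u) ^ k) t =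
      ∑ p ∈ antidiagonal k, (((p.1.factorial : F)⁻¹) • u ^ p.1) * t *
        (((p.2.factorial : F)⁻¹) • (-u) ^ p.2) := by
  have had : LieAlgebra.ad F R u = LinearMap.mulLeft F u + LinearMap.mulRight F (-u) := by
    ext x
    simp [LieRing.of_associative_ring_bracket, sub_eq_add_neg]
  rw [had, (LinearMap.commute_mulLeft_right u (-u)).add_pow', LinearMap.sum_apply, smul_sum]
  refine sum_congr rfl fun p hp => ?_
  obtain rfl := HasAntidiagonal.mem_antidiagonal.1 hp
  rw [LinearMap.pow_mulLeft, LinearMap.pow_mulRight, LinearMap.smul_apply,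
    Module.End.mul_apply, LinearMap.mulLeft_apply, LinearMap.mulRight_apply,
    ← Nat.cast_smul_eq_nsmul F, smul_smul, smul_mul_assoc, smul_mul_smul_comm, mul_assoc]
  congr 1
  rw [Nat.choose_symm_add, Nat.add_choose,
    Nat.cast_div (Nat.factorial_mul_factorial_dvd_factorial_add _ _)
      (by exact_mod_cast mul_ne_zero (Nat.factorial_ne_zero _) (Nat.factorial_ne_zero _))]
  have := Nat.factorial_ne_zero (p.1 + p.2)
  push_cast
  field_simp

namespace MagnusSemidirect

namespace MagnusAlgebra

variable {F X : Type*} [Field F]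

theorem component_zero_mul (u v : MagnusAlgebra F X) :
    component 0 (u * v) = component 0 u * component 0 v := by
  simp [component_mul]

theorem component_zero_exp (u : MagnusAlgebra F X) : component 0 (exp u) = 1 := by
  simp [exp, component_one]

theorem exp_sub_sum_mem {u : MagnusAlgebra F X} (hu : component 0 u = 0) (N : ℕ) :
    exp u - ∑ k ∈ range N, ((k.factorial : F)⁻¹) • u ^ k ∈ degreeGE F X N := by
  intro m hm
  rw [component_sub, sub_eq_zero, component_sum]
  simp only [exp, component_ofComponents, component_smul]
  refine sum_subset (range_subset_range.2 hm) fun k _ hk => ?_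
  rw [component_pow_eq_zero hu k m (by simpa using hk), smul_zero]

/-- `exp u` determines `u`: modulo degree `n + 1`, the powers `uᵏ` with `k ≥ 2` depend only on the
components of `u` of degree less than `n`. -/
theorem exp_injective {u v : MagnusAlgebra F X} (hu : component 0 u = 0) (hv : component 0 v = 0)
    (h : exp u = exp v) : u = v := by
  have hstep : ∀ n, u - v ∈ degreeGE F X (n + 1) := by
    intro n
    induction n with
    | zero => exact mem_degreeGE_one.2 (by rw [component_sub, hu, hv, sub_zero])
    | succ n ih =>
      have hpow : ∀ k, u ^ (k + 1) - v ^ (k + 1) ∈ degreeGE F X (n + 1 + k) := by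
        intro k
        induction k with
        | zero => simpa using ih
        | succ k ihk =>
          have h1 := mul_mem_degreeGE ih (pow_mem_degreeGE hv (k + 1))
          have h2 := mul_mem_degreeGE (mem_degreeGE_one.2 hu) ihk
          have h3 : u ^ (k + 1 + 1) - v ^ (k + 1 + 1) =
              (u - v) * v ^ (k + 1) + u * (u ^ (k + 1) - v ^ (k + 1)) := by
            rw [pow_succ' u, pow_succ' v, sub_mul, mul_sub]
            abel
          rw [h3]
          refine Submodule.add_mem _ h1 (degreeGE_anti ?_ h2)
          omega
      have hu' := exp_sub_sum_mem hu (n + 2)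
      have hv' := exp_sub_sum_mem hv (n + 2)
      rw [sum_range_succ', sum_range_succ'] at hu' hv'
      have hk : ∑ k ∈ range n, (((k + 1 + 1).factorial : F)⁻¹) • u ^ (k + 1 + 1) -
          ∑ k ∈ range n, (((k + 1 + 1).factorial : F)⁻¹) • v ^ (k + 1 + 1) ∈
            degreeGE F X (n + 2) := by
        rw [← sum_sub_distrib]
        refine Submodule.sum_mem _ fun k _ => ?_
        rw [← smul_sub]
        exact Submodule.smul_mem _ _ (degreeGE_anti (by omega) (hpow (k + 1)))
      have := sub_mem (sub_mem hv' hu') hk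
      rw [h] at this
      convert this using 1
      simp
      abel
  exact eq_of_sub_mem_degreeGE fun n => degreeGE_anti (Nat.le_succ n) (hstep n)

section CharZero

variable [CharZero F]

/-- `e^u T(e^{-u}) = ∑ₖ (1 / k!) ((ad u)ᵏ T)(1)` for a linear operator `T` respecting the degree
filtration, where `u` also denotes the operator of left multiplication by `u`.  For `T` a left
multiplication this is the formula for conjugation by `e^u`, for `T` a derivation the one for its
logarithmic derivative. -/
theorem exp_mul_map_exp_neg_sub_sum_mem {u : MagnusAlgebra F X} (hu : component 0 u = 0)
    (T : Module.End F (MagnusAlgebra F X))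
    (hT : ∀ n, ∀ x ∈ degreeGE F X n, T x ∈ degreeGE F X n) (N : ℕ) :
    exp u * T (exp (-u)) - ∑ k ∈ range N, ((k.factorial : F)⁻¹) •
      ((LieAlgebra.ad F (Module.End F (MagnusAlgebra F X)) (LinearMap.mulLeft F u)) ^ k) T 1 ∈
        degreeGE F X N := by
  have hu' : component 0 (-u) = 0 := by rw [component_neg, hu, neg_zero]
  have hterm : ∀ k, ((k.factorial : F)⁻¹) •
      ((LieAlgebra.ad F (Module.End F (MagnusAlgebra F X)) (LinearMap.mulLeft F u)) ^ k) T 1 =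
      ∑ p ∈ antidiagonal k, (((p.1.factorial : F)⁻¹) • u ^ p.1) *
        T (((p.2.factorial : F)⁻¹) • (-u) ^ p.2) := by
    intro k
    rw [← LinearMap.smul_apply, LieAlgebra.inv_factorial_smul_ad_pow, LinearMap.sum_apply]
    refine sum_congr rfl fun p _ => ?_
    have hneg : -LinearMap.mulLeft F u = LinearMap.mulLeft F (-u) :=
      LinearMap.ext fun x => (neg_mul u x).symm
    rw [hneg, LinearMap.pow_mulLeft, LinearMap.pow_mulLeft]
    simp
  simp only [hterm]
  set P := ∑ k ∈ range N, ((k.factorial : F)⁻¹) • u ^ k with hP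
  set Q := ∑ k ∈ range N, ((k.factorial : F)⁻¹) • (-u) ^ k with hQ
  have h1 := mul_mem_degreeGE_left (exp_sub_sum_mem hu N) (T Q)
  have h2 := mul_mem_degreeGE_right (exp u) (hT N _ (exp_sub_sum_mem hu' N))
  have h3 := sum_square_sub_sum_triangle_mem
    (fun i j => (((i.factorial : F)⁻¹) • u ^ i) * T (((j.factorial : F)⁻¹) • (-u) ^ j))
    (fun i j => mul_mem_degreeGE (Submodule.smul_mem _ _ (pow_mem_degreeGE hu i))
      (hT _ _ (Submodule.smul_mem _ _ (pow_mem_degreeGE hu' j)))) N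
  rw [← sum_mul_sum, ← map_sum, ← hP, ← hQ] at h3
  rw [← hP] at h1
  rw [← hQ] at h2
  have := add_mem (add_mem h1 h2) h3
  convert this using 1
  rw [map_sub, sub_mul, mul_sub]
  abel

omit [CharZero F] in
theorem ad_mulLeft_pow_mulLeft (u w : MagnusAlgebra F X) (k : ℕ) :
    ((LieAlgebra.ad F (Module.End F (MagnusAlgebra F X)) (LinearMap.mulLeft F u)) ^ k)
      (LinearMap.mulLeft F w) =
    LinearMap.mulLeft F (((LieAlgebra.ad F (MagnusAlgebra F X) u) ^ k) w) := by
  induction k with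
  | zero => simp
  | succ k ih =>
    rw [pow_succ', pow_succ', Module.End.mul_apply, Module.End.mul_apply, ih]
    refine LinearMap.ext fun x => ?_
    simp [LieRing.of_associative_ring_bracket, sub_mul, mul_assoc]

theorem exp_mul_mul_exp_neg_sub_sum_mem {u : MagnusAlgebra F X} (hu : component 0 u = 0)
    (w : MagnusAlgebra F X) (N : ℕ) :
    exp u * w * exp (-u) - ∑ k ∈ range N, ((k.factorial : F)⁻¹) •
      ((LieAlgebra.ad F (MagnusAlgebra F X) u) ^ k) w ∈ degreeGE F X N := by
  have := exp_mul_map_exp_neg_sub_sum_mem hu (LinearMap.mulLeft F w)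
    (fun n x hx => mul_mem_degreeGE_right w hx) N
  simpa only [ad_mulLeft_pow_mulLeft, LinearMap.mulLeft_apply, mul_one, ← mul_assoc] using this

theorem exp_mul_exp_neg {u : MagnusAlgebra F X} (hu : component 0 u = 0) :
    exp u * exp (-u) = 1 := by
  refine eq_of_sub_mem_degreeGE fun N => degreeGE_anti (Nat.le_succ N) ?_
  have h := exp_mul_mul_exp_neg_sub_sum_mem hu 1 (N + 1)
  rw [sum_range_succ', sum_eq_zero] at h
  · simpa using h
  · intro k _
    rw [pow_succ, Module.End.mul_apply, LieAlgebra.ad_apply, LieRing.of_associative_ring_bracket,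
      mul_one, one_mul, sub_self, map_zero, smul_zero]

end CharZero

/-! ### The degree derivation -/

variable (F X) in
/-- The derivation of `Â(X)` multiplying the component of degree `n` by `n`. -/
def degreeDerivation : Module.End F (MagnusAlgebra F X) where
  toFun u := ofComponents (fun n => (n : F) • component n u)
    fun n => Submodule.smul_mem _ _ (component_mem n u)
  map_add' u v := by ext n; simp
  map_smul' c u := by ext n; simp [smul_comm c]

@[simp] theorem component_degreeDerivation (n : ℕ) (u : MagnusAlgebra F X) :
    component n (degreeDerivation F X u) = (n : F) • component n u :=
  PowerSeries.coeff_mk n fun n => (n : F) • component n u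

theorem degreeDerivation_mul (u v : MagnusAlgebra F X) :
    degreeDerivation F X (u * v) =
      degreeDerivation F X u * v + u * degreeDerivation F X v := by
  ext n
  rw [component_add, component_degreeDerivation, component_mul, component_mul, component_mul,
    smul_sum, ← sum_add_distrib]
  refine sum_congr rfl fun p hp => ?_
  rw [← HasAntidiagonal.mem_antidiagonal.1 hp]
  simp [add_smul]

@[simp] theorem degreeDerivation_one : degreeDerivation F X 1 = 0 := by
  ext n
  rw [component_degreeDerivation, component_one, component_zero]
  split_ifs with h <;> simp [h]

theorem ad_mulLeft_pow_succ_degreeDerivation (u : MagnusAlgebra F X) (k : ℕ) :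
    ((LieAlgebra.ad F (Module.End F (MagnusAlgebra F X)) (LinearMap.mulLeft F u)) ^ (k + 1))
      (degreeDerivation F X) =
    -LinearMap.mulLeft F
      (((LieAlgebra.ad F (MagnusAlgebra F X) u) ^ k) (degreeDerivation F X u)) := by
  have h : LieAlgebra.ad F (Module.End F (MagnusAlgebra F X)) (LinearMap.mulLeft F u)
      (degreeDerivation F X) = -LinearMap.mulLeft F (degreeDerivation F X u) := by
    refine LinearMap.ext fun x => ?_
    rw [LieAlgebra.ad_apply, LieRing.of_associative_ring_bracket]
    simp [degreeDerivation_mul]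
  rw [pow_succ, Module.End.mul_apply, h, LinearMap.map_neg,
    ad_mulLeft_pow_mulLeft]

/-- The logarithmic derivative of the exponential:
`e^u D(e^{-u}) = -∑ₖ (1 / (k + 1)!) (ad u)ᵏ (D u)`. -/
theorem exp_mul_degreeDerivation_exp_neg_add_sum_mem [CharZero F] {u : MagnusAlgebra F X}
    (hu : component 0 u = 0) (N : ℕ) :
    exp u * degreeDerivation F X (exp (-u)) + ∑ k ∈ range N, (((k + 1).factorial : F)⁻¹) •
      ((LieAlgebra.ad F (MagnusAlgebra F X) u) ^ k) (degreeDerivation F X u) ∈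
        degreeGE F X (N + 1) := by
  have := exp_mul_map_exp_neg_sub_sum_mem hu (degreeDerivation F X)
    (fun n x hx m hm => by rw [component_degreeDerivation, hx m hm, smul_zero]) (N + 1)
  rw [sum_range_succ'] at this
  simpa [ad_mulLeft_pow_succ_degreeDerivation] using this

/-! ### Lie series -/

theorem component_lie (n : ℕ) (u v : MagnusAlgebra F X) :
    component n ⁅u, v⁆ = ∑ p ∈ antidiagonal n, ⁅component p.1 u, component p.2 v⁆ := by
  rw [LieRing.of_associative_ring_bracket, component_sub, component_mul, component_mul,
    ← Finset.Nat.sum_antidiagonal_swap (f := fun p => component p.1 v * component p.2 u),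
    ← sum_sub_distrib]
  rfl

/-- As neither series has a constant term, the components of `⁅u, v⁆` of degree at most `n` involve
only the components of `u` and `v` of degree less than `n`. -/
theorem component_lie_mem_freeLie {u v : MagnusAlgebra F X} (hu : component 0 u = 0)
    (hv : component 0 v = 0) {n : ℕ} (hun : ∀ m < n, component m u ∈ freeLie F X)
    (hvn : ∀ m < n, component m v ∈ freeLie F X) {m : ℕ} (hm : m ≤ n) :
    component m ⁅u, v⁆ ∈ freeLie F X := by
  rw [component_lie]
  refine sum_mem fun p hp => ?_
  have := HasAntidiagonal.mem_antidiagonal.1 hp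
  rcases Nat.eq_zero_or_pos p.1 with h1 | h1
  · rw [h1, hu, zero_lie]
    exact (freeLie F X).zero_mem
  rcases Nat.eq_zero_or_pos p.2 with h2 | h2
  · rw [h2, hv, lie_zero]
    exact (freeLie F X).zero_mem
  exact (freeLie F X).lie_mem (hun _ (by omega)) (hvn _ (by omega))

theorem component_zero_ad_pow {u w : MagnusAlgebra F X} (hu : component 0 u = 0)
    (hw : component 0 w = 0) (k : ℕ) :
    component 0 (((LieAlgebra.ad F (MagnusAlgebra F X) u) ^ k) w) = 0 := by
  cases k with
  | zero => simpa using hw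
  | succ k =>
    rw [pow_succ', Module.End.mul_apply, LieAlgebra.ad_apply, component_lie]
    simp [hu]

theorem component_ad_pow_succ_mem_freeLie {u w : MagnusAlgebra F X} (hu : component 0 u = 0)
    (hw : component 0 w = 0) {n : ℕ} (hun : ∀ m < n, component m u ∈ freeLie F X)
    (hwn : ∀ m < n, component m w ∈ freeLie F X) (k : ℕ) {m : ℕ} (hm : m ≤ n) :
    component m (((LieAlgebra.ad F (MagnusAlgebra F X) u) ^ (k + 1)) w) ∈ freeLie F X := by
  induction k generalizing m with
  | zero =>
    rw [zero_add, pow_one]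
    exact component_lie_mem_freeLie hu hw hun hwn hm
  | succ k ih =>
    rw [pow_succ', Module.End.mul_apply]
    exact component_lie_mem_freeLie hu (component_zero_ad_pow hu hw _) hun
      (fun m hm => ih hm.le) hm

theorem mem_completedFreeLie_of_sub_mem {x : MagnusAlgebra F X}
    (h : ∀ N, ∃ y ∈ completedFreeLie F X, x - y ∈ degreeGE F X N) :
    x ∈ completedFreeLie F X := by
  refine ⟨?_, fun n => ?_⟩
  · obtain ⟨y, hy, hxy⟩ := h 1
    rw [component_eq_of_sub_mem hxy Nat.one_pos, hy.1]
  · obtain ⟨y, hy, hxy⟩ := h (n + 1)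
    rw [component_eq_of_sub_mem hxy (Nat.lt_succ_self n)]
    exact hy.2 n

theorem ad_pow_mem_completedFreeLie {u w : MagnusAlgebra F X} (hu : u ∈ completedFreeLie F X)
    (hw : w ∈ completedFreeLie F X) (k : ℕ) :
    ((LieAlgebra.ad F (MagnusAlgebra F X) u) ^ k) w ∈ completedFreeLie F X := by
  induction k with
  | zero => simpa using hw
  | succ k ih =>
    rw [pow_succ', Module.End.mul_apply]
    exact (completedFreeLie F X).lie_mem hu ih

theorem degreeDerivation_mem_completedFreeLie {u : MagnusAlgebra F X}
    (hu : u ∈ completedFreeLie F X) : degreeDerivation F X u ∈ completedFreeLie F X :=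
  ⟨by simp, fun n => by
    rw [component_degreeDerivation]
    exact (freeLie F X).smul_mem _ (hu.2 n)⟩

variable [CharZero F]

theorem exp_mul_mul_exp_neg_mem {u w : MagnusAlgebra F X} (hu : u ∈ completedFreeLie F X)
    (hw : w ∈ completedFreeLie F X) : exp u * w * exp (-u) ∈ completedFreeLie F X :=
  mem_completedFreeLie_of_sub_mem fun N => ⟨_, sum_mem fun k _ =>
    (completedFreeLie F X).smul_mem _ (ad_pow_mem_completedFreeLie hu hw k),
    exp_mul_mul_exp_neg_sub_sum_mem hu.1 w N⟩

theorem exp_mul_degreeDerivation_exp_neg_mem {u : MagnusAlgebra F X}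
    (hu : u ∈ completedFreeLie F X) :
    exp u * degreeDerivation F X (exp (-u)) ∈ completedFreeLie F X := by
  refine mem_completedFreeLie_of_sub_mem fun N => ⟨-∑ k ∈ range N, (((k + 1).factorial : F)⁻¹) •
      ((LieAlgebra.ad F (MagnusAlgebra F X) u) ^ k) (degreeDerivation F X u),
    neg_mem (sum_mem fun k _ => (completedFreeLie F X).smul_mem _
      (ad_pow_mem_completedFreeLie hu (degreeDerivation_mem_completedFreeLie hu) k)), ?_⟩
  rw [sub_neg_eq_add]
  exact degreeGE_anti (Nat.le_succ N) (exp_mul_degreeDerivation_exp_neg_add_sum_mem hu.1 N)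

/-- A series is a Lie series as soon as the logarithmic derivative of its exponential is one: in
degree `n` the latter is `-n uₙ` plus a combination of iterated brackets of components of `u` of
degree less than `n`. -/
theorem mem_completedFreeLie_of_exp_mul_degreeDerivation_mem {u : MagnusAlgebra F X}
    (hu : component 0 u = 0)
    (h : exp u * degreeDerivation F X (exp (-u)) ∈ completedFreeLie F X) :
    u ∈ completedFreeLie F X := by
  refine ⟨hu, fun n => ?_⟩
  induction n using Nat.strong_induction_on with
  | _ n ih =>
    rcases Nat.eq_zero_or_pos n with rfl | hn
    · rw [hu]
      exact (freeLie F X).zero_mem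
    have h1 := exp_mul_degreeDerivation_exp_neg_add_sum_mem hu (n + 1) n (by omega)
    rw [sum_range_succ', component_add, component_add, component_sum] at h1
    simp only [zero_add, Nat.factorial_one, Nat.cast_one, inv_one, one_smul, pow_zero,
      Module.End.one_apply, component_degreeDerivation, component_smul] at h1
    have h2 : ∑ k ∈ range n, (((k + 1 + 1).factorial : F)⁻¹) • component n
        (((LieAlgebra.ad F (MagnusAlgebra F X) u) ^ (k + 1)) (degreeDerivation F X u)) ∈
          freeLie F X := by
      refine sum_mem fun k _ => (freeLie F X).smul_mem _ ?_
      refine component_ad_pow_succ_mem_freeLie hu (by simp) ih (fun m hm => ?_) k le_rfl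
      rw [component_degreeDerivation]
      exact (freeLie F X).smul_mem _ (ih m hm)
    have h3 : (n : F) • component n u ∈ freeLie F X := by
      rw [← add_assoc, add_comm] at h1
      rw [eq_neg_of_add_eq_zero_left h1]
      exact neg_mem (add_mem (h.2 n) h2)
    have h4 := (freeLie F X).smul_mem ((n : F)⁻¹) h3
    rwa [inv_smul_smul₀ (Nat.cast_ne_zero.2 hn.ne')] at h4

end MagnusAlgebra

open MagnusAlgebra

/-! ### Logarithms of elements of the Magnus group -/

variable {F X : Type*} [Field F]

theorem component_zero_of_mem_magnusGroup {g : (MagnusAlgebra F X)ˣ} (hg : g ∈ magnusGroup F X) :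
    component 0 (g : MagnusAlgebra F X) = 1 := by
  induction hg using Subgroup.closure_induction with
  | mem g hg =>
    obtain ⟨L, -, hg⟩ := hg
    rw [hg, component_zero_exp]
  | one => simp [component_one]
  | mul g g' _ _ hg hg' => rw [Units.val_mul, component_zero_mul, hg, hg', one_mul]
  | inv g _ hg =>
    have h := congrArg (component 0) g.mul_inv
    rwa [component_zero_mul, hg, one_mul, component_one, if_pos rfl] at h

variable [CharZero F]

theorem coe_inv_of_eq_exp {g : (MagnusAlgebra F X)ˣ} {L : MagnusAlgebra F X}
    (hL : component 0 L = 0) (hg : (g : MagnusAlgebra F X) = exp L) :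
    ((g⁻¹ : (MagnusAlgebra F X)ˣ) : MagnusAlgebra F X) = exp (-L) :=
  Units.inv_eq_of_mul_eq_one_right (by rw [hg, exp_mul_exp_neg hL])

theorem conj_mem_completedFreeLie {g : (MagnusAlgebra F X)ˣ} (hg : g ∈ magnusGroup F X) :
    ∀ w ∈ completedFreeLie F X, (g : MagnusAlgebra F X) * w * (g⁻¹ : (MagnusAlgebra F X)ˣ) ∈
        completedFreeLie F X ∧
      ((g⁻¹ : (MagnusAlgebra F X)ˣ) : MagnusAlgebra F X) * w * g ∈ completedFreeLie F X := by
  induction hg using Subgroup.closure_induction with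
  | mem g hg =>
    obtain ⟨L, hL, hg⟩ := hg
    intro w hw
    rw [coe_inv_of_eq_exp hL.1 hg, hg]
    refine ⟨exp_mul_mul_exp_neg_mem hL hw, ?_⟩
    simpa using exp_mul_mul_exp_neg_mem (neg_mem hL) hw
  | one => intro w hw; simpa using hw
  | mul g g' _ _ hg hg' =>
    intro w hw
    refine ⟨?_, ?_⟩
    · simpa [mul_assoc] using (hg _ (hg' w hw).1).1
    · simpa [mul_assoc] using (hg' _ (hg w hw).2).2
  | inv g _ hg => intro w hw; simpa using (hg w hw).symm

/-- The logarithmic derivative is a crossed homomorphism,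
`g g' D((g g')⁻¹) = g (g' D(g'⁻¹)) g⁻¹ + g D(g⁻¹)`, so that it takes values in the Lie series on
the whole group generated by the exponentials of Lie series. -/
theorem mul_degreeDerivation_inv_mem {g : (MagnusAlgebra F X)ˣ} (hg : g ∈ magnusGroup F X) :
    (g : MagnusAlgebra F X) * degreeDerivation F X (g⁻¹ : (MagnusAlgebra F X)ˣ) ∈
      completedFreeLie F X := by
  induction hg using Subgroup.closure_induction with
  | mem g hg =>
    obtain ⟨L, hL, hg⟩ := hg
    rw [coe_inv_of_eq_exp hL.1 hg, hg]
    exact exp_mul_degreeDerivation_exp_neg_mem hL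
  | one => simp
  | mul g g' hgm _ hg hg' =>
    have h := add_mem (conj_mem_completedFreeLie hgm _ hg').1 hg
    convert h using 1
    rw [mul_inv_rev, Units.val_mul, Units.val_mul, degreeDerivation_mul, mul_add]
    congr 1
    · simp only [mul_assoc]
    · rw [mul_assoc, Units.mul_inv_cancel_left]
  | inv g hgm hg =>
    have h := neg_mem (conj_mem_completedFreeLie hgm _ hg).2
    convert h using 1
    have h1 := degreeDerivation_mul ((g⁻¹ : (MagnusAlgebra F X)ˣ) : MagnusAlgebra F X) g
    rw [Units.inv_mul, degreeDerivation_one] at h1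
    rw [inv_inv, Units.inv_mul_cancel_left]
    exact eq_neg_of_add_eq_zero_right h1.symm

theorem log_mem_completedFreeLie {g : (MagnusAlgebra F X)ˣ} (hg : g ∈ magnusGroup F X) :
    log (g : MagnusAlgebra F X) ∈ completedFreeLie F X := by
  have h0 := component_zero_log (g : MagnusAlgebra F X)
  have hexp := exp_log (component_zero_of_mem_magnusGroup hg)
  refine mem_completedFreeLie_of_exp_mul_degreeDerivation_mem h0 ?_
  rw [← coe_inv_of_eq_exp h0 hexp.symm, hexp]
  exact mul_degreeDerivation_inv_mem hg

omit [CharZero F] in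
theorem magnusExp_injective : Function.Injective (magnusExp (F := F) (X := X)) := by
  intro L L' h
  refine Subtype.ext (exp_injective L.2.1 L'.2.1 ?_)
  exact congrArg (fun g : magnusGroup F X => ((g : (MagnusAlgebra F X)ˣ) : MagnusAlgebra F X)) h

end MagnusSemidirect

end

theorem lemma3p3 {K : Subfield ℂ} {I : Type*} [Countable I] (A : Matrix I I K)
    (hA : MagnusSemidirect.IsBorcherdsMatrix A)
    (hA_im : ∀ i j, i ∉ MagnusSemidirect.realIndices A → j ∉ MagnusSemidirect.realIndices A →
      i ≠ j → (A i j : ℂ) < 0)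
    {S : Type*} (b : Module.Basis S K (MagnusSemidirect.moduleV A))
    (n₁ n₂ : MagnusSemidirect.magnusGroup K S) (g₁ g₂ : MagnusSemidirect.groupGJ A) :
    ∃ L : MagnusSemidirect.completedFreeLie K S,
      (L : MagnusSemidirect.MagnusAlgebra K S) =
          MagnusSemidirect.MagnusAlgebra.log
            ((n₂ : (MagnusSemidirect.MagnusAlgebra K S)ˣ) : MagnusSemidirect.MagnusAlgebra K S) ∧
        MagnusSemidirect.magnusExp L = n₂ ∧
        (∀ L' : MagnusSemidirect.completedFreeLie K S,
          MagnusSemidirect.magnusExp L' = n₂ → L' = L) ∧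
        (⟨n₁, g₁⟩ * ⟨n₂, g₂⟩ : MagnusSemidirect.SemidirectGroup b) =
          ⟨n₁ * MagnusSemidirect.magnusExp (MagnusSemidirect.adjointAction b g₁ L), g₁ * g₂⟩ := by
  have hexp : MagnusSemidirect.magnusExp
      ⟨_, MagnusSemidirect.log_mem_completedFreeLie n₂.2⟩ = n₂ :=
    Subtype.ext (Units.ext (MagnusSemidirect.MagnusAlgebra.exp_log
      (MagnusSemidirect.component_zero_of_mem_magnusGroup n₂.2)))
  refine ⟨⟨_, MagnusSemidirect.log_mem_completedFreeLie n₂.2⟩, rfl, hexp,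
    fun L' hL' => MagnusSemidirect.magnusExp_injective (hL'.trans hexp.symm), ?_⟩
  refine SemidirectProduct.ext ?_ rfl
  rw [SemidirectProduct.mul_left]
  congr 1
  -- `φ(g)(exp L) = exp(Ad(g)(L))`, as `g` acts on series componentwise by algebra homomorphisms.
  conv_lhs => rw [← hexp]
  exact Subtype.ext (Units.ext (MagnusSemidirect.completeHom_exp _ _ _))
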